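/- Let $d\ge 2$ and $m\ge 0$ be integers, let $S=S^{d-1}\subset\mathbb R^d$ be the unit sphere, and let $d\zeta$ denote the rotation-invariant surface measure on $S$ normalized to be a probability measure. Let $u:\mathbb R^d\to\mathbb C$ be a harmonic polynomial function, homogeneous of degree $m$. For an integer $p\ge 1$ and $f\in C^\infty(\mathbb R^d)$ (complex-valued) define $L_u^pf:\mathbb R^p\to\mathbb C$ by $$L_u^pf(x)=\int_S f(|x|\zeta)\,\overline{u(\zeta/|x|)}\,d\zeta\quad(x\neq 0),\qquad L_u^pf(0)=\sum_{|\alpha|=m}\frac{(\partial^\alpha f)(0)}{\alpha!}\int_S\zeta^\alpha\,\overline{u(\zeta)}\,d\zeta .$$ A function on $\mathbb R^p$ is called radial if its value at $x$ depends only on the Euclidean norm $|x|$. Let $\mathcal S(\mathbb R^d)$ be the Schwartz space of complex-valued functions, let $\mathcal S_{\mathrm{rad}}(\mathbb R^p)\subset\mathcal S(\mathbb R^p)$ be the subspace of radial functions with the subspace topology, and let $\mathcal F(f)(\xi)=\int_{\mathbb R^n} f(x)e^{-2\pi i x\cdot\xi}\,dx$ denote the Fourier transform on $\mathbb R^n$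 ($n=d$ or $n=d+2m$). Then: (i) for every $p\ge 1$ and every $f\in C^\infty(\mathbb R^d)$, the function $L_u^pf$ is smooth and radial on $\mathbb R^p$; (ii) for every $p\ge 1$, the assignment $f\mapsto L_u^pf$ defines a continuous linear map $\mathcal S(\mathbb R^d)\to\mathcal S_{\mathrm{rad}}(\mathbb R^p)$; (iii) for every $f\in\mathcal S(\mathbb R^d)$, $\mathcal F(L_u^{d+2m}f)=i^m\,L_u^{d+2m}\mathcal F(f)$ on $\mathbb R^{d+2m}$. -/

import Mathlib

open MeasureTheory Complex
open scoped FourierTransform SchwartzMap ContDiff ComplexConjugate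

noncomputable section

/-- The Euclidean space `ℝ^d`, with the Euclidean norm and Lebesgue measure. -/
abbrev RSpace (d : ℕ) : Type := EuclideanSpace ℝ (Fin d)

/-- The unit sphere `S^{d-1}` in `ℝ^d`. -/
abbrev USphere (d : ℕ) : Type := Metric.sphere (0 : RSpace d) 1

/-- The surface measure on `S^{d-1}`, normalized to be a probability measure. -/
def sphereProb (d : ℕ) : Measure (USphere d) :=
  ((volume : Measure (RSpace d)).toSphere Set.univ)⁻¹ • (volume : Measure (RSpace d)).toSphere

/-- `u` belongs to `H_m(ℝ^d)`: it is a complex-valued polynomial function on `ℝ^d`, homogeneous of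
degree `m`, and harmonic. -/
structure IsHarmonicPoly (d m : ℕ) (u : RSpace d → ℂ) : Prop where
  isHomogeneous : ∃ P : MvPolynomial (Fin d) ℂ, P.IsHomogeneous m ∧
    ∀ x, u x = MvPolynomial.eval (fun i => ((x i : ℝ) : ℂ)) P
  harmonic : InnerProductSpace.HarmonicOnNhd u Set.univ

/-- A function on `ℝ^p` is radial if its value at a point depends only on the norm. -/
def IsRadialFun {p : ℕ} (g : RSpace p → ℂ) : Prop :=
  ∀ x y, ‖x‖ = ‖y‖ → g x = g y

/-- The space of radial Schwartz functions on `ℝ^p`, with the subspace topology. -/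
def radialSchwartz (p : ℕ) : Submodule ℂ 𝓢(RSpace p, ℂ) where
  carrier := {g | IsRadialFun (g : RSpace p → ℂ)}
  add_mem' := by
    intro a b ha hb x y h
    simp [ha x y h, hb x y h]
  zero_mem' := by
    intro x y _
    simp
  smul_mem' := by
    intro c a ha x y h
    simp [ha x y h]

/-- The `i`-th partial derivative. -/
def partialD {d : ℕ} (i : Fin d) (f : RSpace d → ℂ) : RSpace d → ℂ :=
  fun x => lineDeriv ℝ f x (EuclideanSpace.single i 1)

/-- The partial derivative `∂^α = ∂_0^{α 0} ∂_1^{α 1} ⋯` for a multi-index `α`. -/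
def multiD {d : ℕ} (α : Fin d → ℕ) (f : RSpace d → ℂ) : RSpace d → ℂ :=
  (List.finRange d).foldr (fun i g => (partialD i)^[α i] g) f

open Classical in
/-- The lift `L_u^p f : ℝ^p → ℂ` of `f : ℝ^d → ℂ`, for `u` homogeneous of degree `m`.
The finset `Finset.piAntidiag Finset.univ m` consists of the multi-indices `α` with `|α| = m`. -/
def sphereLift {d : ℕ} (p m : ℕ) (u f : RSpace d → ℂ) (x : RSpace p) : ℂ :=
  if x = 0 then
    ∑ α ∈ Finset.piAntidiag (Finset.univ : Finset (Fin d)) m,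
      multiD α f 0 / ((∏ i, (α i).factorial : ℕ) : ℂ) *
        ∫ ζ : USphere d,
          ((∏ i, (ζ : RSpace d) i ^ α i : ℝ) : ℂ) * conj (u (ζ : RSpace d)) ∂(sphereProb d)
  else
    ∫ ζ : USphere d,
      f (‖x‖ • (ζ : RSpace d)) * conj (u (‖x‖⁻¹ • (ζ : RSpace d))) ∂(sphereProb d)

end

/-!
# Lifting functions by integration against a harmonic polynomial

Let `v = conj u`, which is again a harmonic polynomial, homogeneous of degree `m`. The weighted
spherical mean `φ(r) = ∫_S f(r ζ) v(ζ) dζ` is a smooth function of `r ∈ ℝ`. It has the parity of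
`m`, because the measure on the sphere is invariant under the antipodal map, and its derivatives at
`0` of order `k < m` vanish, because they are integrals of `v` against homogeneous polynomials of
degree `k`. So `φ(r) = r ^ m ψ(r)` with `ψ` smooth and even (`iterate_hadamardQuot`), and the lift
is `x ↦ ψ ‖x‖` (`sphereLift_eq_liftProfile`); the Taylor coefficient `ψ(0)` is the value prescribed
at the origin.

An even smooth function `ψ` of the norm is smooth: its derivative at `x` is
`⟪x, ·⟫ • (ψ'(r) / r)` at `r = ‖x‖`, and `ψ'(r) / r` is again smooth and even
(`contDiff_comp_norm`). The Schwartz seminorms of division by `r` and of composition with the norm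
are controlled by the same inductions (`RapidlyDecreasing.hadamardQuot`,
`RapidlyDecreasing.comp_norm`), which gives the continuous linear map `liftCLM`.

Two facts about harmonic polynomials `P` are needed: the orthogonality to lower degrees on the
sphere (`integral_sphereProb_mul_eq_zero`) and Hecke's identity for the Fourier transform of
`P(x) e^{-π t |x|²}` (`fourier_harmonic_mul_gauss`). Both follow by induction on the degree from
`euler_gaussWaveIntegral`: write `m P = ∑ x_i ∂_i P`, integrate by parts against the Gaussian, and
use `ΔP = 0`.

For the intertwining property, polar coordinates in `ℝ^(d+2m)` and in `ℝ^d` show that the integral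
of the lift of `f` against a Gaussian is a constant times the integral of `f v` against the same
Gaussian (`integral_liftCLM_mul_gauss`). With the self-adjointness of the Fourier transform and
Hecke's identity, both sides of the claim have the same integrals against all Gaussians `e^{-π n |x|²}`,
`n ≥ 1`. A radial Schwartz function is a continuous function of `e^{-π|x|²} ∈ [0, 1]`, so by the
Weierstrass approximation theorem it is determined by these integrals
(`schwartz_eq_zero_of_integral_gauss`).
-/

/-! ### Differentiation under the integral sign over a compact parameter space -/

section ParametricIntegral

variable {K : Type*} [TopologicalSpace K] [CompactSpace K] [MeasurableSpace K]
  [OpensMeasurableSpace K] (μ : Measure K) [IsFiniteMeasure μ]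

theorem hasDerivAt_integral_of_compactSpace {G G' : ℝ → K → ℂ}
    (hG : Continuous (Function.uncurry G)) (hG' : Continuous (Function.uncurry G'))
    (hd : ∀ r k, HasDerivAt (fun s => G s k) (G' r k) r) (r : ℝ) :
    HasDerivAt (fun r => ∫ k, G r k ∂μ) (∫ k, G' r k ∂μ) r := by
  obtain ⟨C, hC⟩ := ((isCompact_closedBall r 1).prod
    (isCompact_univ (X := K))).exists_bound_of_continuousOn hG'.continuousOn
  have hsec : ∀ {H : ℝ → K → ℂ}, Continuous (Function.uncurry H) → ∀ s, Continuous (H s) :=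
    fun h s => h.comp (Continuous.prodMk_right s)
  refine (hasDerivAt_integral_of_dominated_loc_of_deriv_le (bound := fun _ => C)
    (Metric.closedBall_mem_nhds r one_pos)
    (Filter.Eventually.of_forall fun s => (hsec hG s).aestronglyMeasurable)
    ?_ (hsec hG' r).aestronglyMeasurable ?_ (integrable_const C) ?_).2
  · exact (hsec hG r).integrable_of_hasCompactSupport (HasCompactSupport.of_compactSpace _)
  · exact Filter.Eventually.of_forall fun k s hs => hC (s, k) ⟨hs, Set.mem_univ _⟩
  · exact Filter.Eventually.of_forall fun k s _ => hd s k

variable {G : ℕ → ℝ → K → ℂ} (hG : ∀ n, Continuous (Function.uncurry (G n)))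
  (hd : ∀ n r k, HasDerivAt (fun s => G n s k) (G (n + 1) r k) r)

include hG hd

theorem iteratedDeriv_integral_of_compactSpace (n : ℕ) :
    iteratedDeriv n (fun r => ∫ k, G 0 r k ∂μ) = fun r => ∫ k, G n r k ∂μ := by
  induction n with
  | zero => simp
  | succ n ih =>
    rw [iteratedDeriv_succ, ih]
    exact funext fun r =>
      (hasDerivAt_integral_of_compactSpace μ (hG n) (hG (n + 1)) (hd n) r).deriv

theorem contDiff_integral_of_compactSpace : ContDiff ℝ ∞ (fun r => ∫ k, G 0 r k ∂μ) := by
  refine contDiff_of_differentiable_iteratedDeriv fun n _ => ?_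
  rw [iteratedDeriv_integral_of_compactSpace μ hG hd n]
  exact fun r =>
    (hasDerivAt_integral_of_compactSpace μ (hG n) (hG (n + 1)) (hd n) r).differentiableAt

end ParametricIntegral

/-! ### Hadamard division by the variable -/

/-- Hadamard's quotient `(h r - h 0) / r` of a smooth function `h` of a real variable, written as
the integral `∫₀¹ h'(t r) dt`, which makes sense at `r = 0` too. -/
noncomputable def hadamardQuot (h : ℝ → ℂ) (r : ℝ) : ℂ :=
  ∫ t : unitInterval, deriv h (t * r)

theorem mul_hadamardQuot {h : ℝ → ℂ} (hh : ContDiff ℝ ∞ h) (r : ℝ) :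
    (r : ℂ) * hadamardQuot h r = h r - h 0 := by
  have h1 : hadamardQuot h r = ∫ t in (0 : ℝ)..1, deriv h (t * r) := by
    rw [intervalIntegral.integral_of_le zero_le_one, ← integral_Icc_eq_integral_Ioc]
    exact integral_subtype_comap measurableSet_Icc fun t : ℝ => deriv h (t * r)
  have hdiff : Differentiable ℝ h := hh.differentiable (by simp)
  have hderiv : ∀ t ∈ Set.uIcc (0 : ℝ) 1,
      HasDerivAt (fun t : ℝ => h (t * r)) ((r : ℂ) * deriv h (t * r)) t := fun t _ => by
    have := (hdiff (t * r)).hasDerivAt.scomp t ((hasDerivAt_id t).mul_const r)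
    simpa [Function.comp_def] using this
  have hcont : Continuous fun t : ℝ => (r : ℂ) * deriv h (t * r) :=
    continuous_const.mul ((hh.continuous_deriv (by simp)).comp (by fun_prop))
  have := intervalIntegral.integral_eq_sub_of_hasDerivAt hderiv (hcont.intervalIntegrable 0 1)
  rw [intervalIntegral.integral_const_mul] at this
  rw [h1, this]
  simp

theorem hadamardQuot_parity {h : ℝ → ℂ} {ε : ℂ} (hε : ∀ r, h (-r) = ε * h r) (r : ℝ) :
    hadamardQuot h (-r) = -ε * hadamardQuot h r := by
  have h1 : ∀ r, deriv h (-r) = -ε * deriv h r := fun r => by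
    have h2 := deriv_comp_neg h r
    have h3 : (fun x => h (-x)) = fun x => ε * h x := funext hε
    rw [h3, deriv_const_mul_field] at h2
    rw [neg_mul, h2, neg_neg]
  simp only [hadamardQuot, mul_neg, h1]
  rw [integral_const_mul]

theorem iterate_hadamardQuot_even {h : ℝ → ℂ} (m : ℕ)
    (hε : ∀ r, h (-r) = (-1) ^ m * h r) (r : ℝ) :
    hadamardQuot^[m] h (-r) = hadamardQuot^[m] h r := by
  suffices H : ∀ j ≤ m, ∀ r, hadamardQuot^[j] h (-r) = (-1) ^ (m + j) * hadamardQuot^[j] h r by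
    simpa [← two_mul] using H m le_rfl r
  intro j
  induction j with
  | zero => simpa using hε
  | succ j ih =>
    intro hj r
    rw [Function.iterate_succ_apply', hadamardQuot_parity (ih (by omega))]
    ring

section

variable {h : ℝ → ℂ} (hh : ContDiff ℝ ∞ h)
include hh

theorem continuous_hadamardQuot_kernel (n : ℕ) : Continuous (Function.uncurry
    fun (r : ℝ) (t : unitInterval) => ((t : ℝ) : ℂ) ^ n * iteratedDeriv (n + 1) h (t * r)) := by
  have := hh.continuous_iteratedDeriv (n + 1) (by exact_mod_cast le_top)
  simp only [Function.uncurry_def]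
  fun_prop

theorem hasDerivAt_hadamardQuot_kernel (n : ℕ) (r : ℝ) (t : unitInterval) :
    HasDerivAt (fun s : ℝ => ((t : ℝ) : ℂ) ^ n * iteratedDeriv (n + 1) h (t * s))
      (((t : ℝ) : ℂ) ^ (n + 1) * iteratedDeriv (n + 1 + 1) h (t * r)) r := by
  have hd : Differentiable ℝ (iteratedDeriv (n + 1) h) :=
    hh.differentiable_iteratedDeriv _ (by exact_mod_cast WithTop.coe_lt_top _)
  have h1 := ((hd (t * r)).hasDerivAt.scomp r ((hasDerivAt_id r).const_mul (t : ℝ))).const_mul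
    (((t : ℝ) : ℂ) ^ n)
  convert! h1 using 1
  rw [iteratedDeriv_succ (n := n + 1)]
  simp
  ring

theorem iteratedDeriv_hadamardQuot (n : ℕ) (r : ℝ) :
    iteratedDeriv n (hadamardQuot h) r =
      ∫ t : unitInterval, ((t : ℝ) : ℂ) ^ n * iteratedDeriv (n + 1) h (t * r) := by
  have := congrFun (iteratedDeriv_integral_of_compactSpace (volume : Measure unitInterval)
    (continuous_hadamardQuot_kernel hh) (hasDerivAt_hadamardQuot_kernel hh) n) r
  unfold hadamardQuot
  simpa using this

theorem contDiff_hadamardQuot : ContDiff ℝ ∞ (hadamardQuot h) := by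
  have := contDiff_integral_of_compactSpace (volume : Measure unitInterval)
    (continuous_hadamardQuot_kernel hh) (hasDerivAt_hadamardQuot_kernel hh)
  unfold hadamardQuot
  simpa using this

theorem iteratedDeriv_hadamardQuot_zero (n : ℕ) :
    iteratedDeriv n (hadamardQuot h) 0 = iteratedDeriv (n + 1) h 0 / (n + 1) := by
  rw [iteratedDeriv_hadamardQuot hh]
  have h1 : ∫ t : unitInterval, ((t : ℝ) : ℂ) ^ n = 1 / (n + 1) := by
    have h2 : ∫ t : unitInterval, ((t : ℝ) : ℂ) ^ n = ∫ t in (0 : ℝ)..1, (t : ℂ) ^ n := by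
      rw [intervalIntegral.integral_of_le zero_le_one, ← integral_Icc_eq_integral_Ioc]
      exact integral_subtype_comap measurableSet_Icc fun t : ℝ => (t : ℂ) ^ n
    rw [h2]
    have h3 : ∀ t : ℝ, (t : ℂ) ^ n = ((t ^ n : ℝ) : ℂ) := fun t => by push_cast; rfl
    simp only [h3]
    rw [intervalIntegral.integral_ofReal, integral_pow]
    simp
  simp only [mul_zero]
  rw [integral_mul_const, h1]
  ring

/-- The bound on the derivatives of the quotient near the origin. -/
theorem norm_iteratedDeriv_hadamardQuot_le {n : ℕ} {B : ℝ}
    (hB : ∀ r, ‖iteratedDeriv (n + 1) h r‖ ≤ B) (r : ℝ) :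
    ‖iteratedDeriv n (hadamardQuot h) r‖ ≤ B := by
  rw [iteratedDeriv_hadamardQuot hh]
  have : ∀ t : unitInterval, ‖((t : ℝ) : ℂ) ^ n * iteratedDeriv (n + 1) h (t * r)‖ ≤ B := by
    intro t
    rw [norm_mul, norm_pow, norm_real, Real.norm_of_nonneg t.2.1]
    calc (t : ℝ) ^ n * ‖iteratedDeriv (n + 1) h (t * r)‖ ≤ 1 * B :=
          mul_le_mul (pow_le_one₀ t.2.1 t.2.2) (hB _) (norm_nonneg _) zero_le_one
      _ = B := one_mul B
  simpa using norm_integral_le_of_norm_le_const (μ := (volume : Measure unitInterval))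
    (Filter.Eventually.of_forall this)

/-- Differentiating `r * q(r) = h(r)` repeatedly, where `q` is the quotient of `h` by `r`. -/
theorem mul_iteratedDeriv_hadamardQuot (h0 : h 0 = 0) (n : ℕ) (r : ℝ) :
    (r : ℂ) * iteratedDeriv n (hadamardQuot h) r +
      n * iteratedDeriv (n - 1) (hadamardQuot h) r = iteratedDeriv n h r := by
  induction n generalizing r with
  | zero => simpa [h0] using mul_hadamardQuot hh r
  | succ n ih =>
    have hd : ∀ k, Differentiable ℝ (iteratedDeriv k (hadamardQuot h)) := fun k =>
      (contDiff_hadamardQuot hh).differentiable_iteratedDeriv _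
        (by exact_mod_cast WithTop.coe_lt_top _)
    have hderiv := fun k => ((hd k) r).hasDerivAt
    simp only [← iteratedDeriv_succ] at hderiv
    have h1 := ((hasDerivAt_id r).ofReal_comp.mul (hderiv n)).add
      ((hderiv (n - 1)).const_mul (n : ℂ))
    have h2 : (fun r : ℝ => (r : ℂ) * iteratedDeriv n (hadamardQuot h) r +
      n * iteratedDeriv (n - 1) (hadamardQuot h) r) = iteratedDeriv n h := funext ih
    rw [iteratedDeriv_succ (f := h), ← h2]
    have h3 := h1.deriv
    simp only [id] at h3
    refine Eq.trans ?_ h3.symm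
    rcases n with _ | n
    · simp; ring
    · simp; ring

/-- A smooth function whose derivatives of order less than `m` vanish at `0` is `r ^ m` times a
smooth function, whose value at `0` is the Taylor coefficient of order `m`. -/
theorem iterate_hadamardQuot (m : ℕ) (h0 : ∀ k < m, iteratedDeriv k h 0 = 0) :
    ContDiff ℝ ∞ (hadamardQuot^[m] h) ∧
    (∀ r : ℝ, (r : ℂ) ^ m * hadamardQuot^[m] h r = h r) ∧
    hadamardQuot^[m] h 0 = iteratedDeriv m h 0 / m.factorial := by
  -- All derivatives of the quotient at `0` are tracked, as the next division needs them.
  suffices H : ContDiff ℝ ∞ (hadamardQuot^[m] h) ∧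
      (∀ r : ℝ, (r : ℂ) ^ m * hadamardQuot^[m] h r = h r) ∧
      ∀ n, iteratedDeriv n (hadamardQuot^[m] h) 0 =
        n.factorial * iteratedDeriv (n + m) h 0 / (n + m).factorial by
    refine ⟨H.1, H.2.1, ?_⟩
    simpa using H.2.2 0
  induction m with
  | zero => simp [hh, Nat.factorial_ne_zero]
  | succ m ih =>
    obtain ⟨h1, h2, h3⟩ := ih fun k hk => h0 k (hk.trans (Nat.lt_succ_self m))
    have h4 : hadamardQuot^[m] h 0 = 0 := by
      simpa [h0 m (Nat.lt_succ_self m)] using h3 0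
    simp only [Function.iterate_succ_apply']
    refine ⟨contDiff_hadamardQuot h1, fun r => ?_, fun n => ?_⟩
    · rw [pow_succ, mul_assoc, mul_hadamardQuot h1, h4, sub_zero, h2]
    · rw [iteratedDeriv_hadamardQuot_zero h1, h3, Nat.factorial_succ n, add_right_comm n 1 m,
        ← add_assoc]
      have : (n : ℂ) + 1 ≠ 0 := by exact_mod_cast Nat.succ_ne_zero n
      push_cast
      field_simp

end

/-! ### Even functions of the norm -/

section Radial

variable {W : Type*} [NormedAddCommGroup W] [InnerProductSpace ℝ W]

theorem deriv_zero_of_even {h : ℝ → ℂ} (heven : ∀ r, h (-r) = h r) : deriv h 0 = 0 := by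
  have h1 := deriv_comp_neg h 0
  rw [show (fun x => h (-x)) = h from funext heven, neg_zero] at h1
  linear_combination h1 / 2

/-- If `h` is even, so is the function `h'(r) / r`. -/
theorem hadamardQuot_deriv_even {h : ℝ → ℂ} (heven : ∀ r, h (-r) = h r) (r : ℝ) :
    hadamardQuot (deriv h) (-r) = hadamardQuot (deriv h) r := by
  have h1 : ∀ r, deriv h (-r) = -1 * deriv h r := fun r => by
    have h1 := deriv_comp_neg h r
    rw [show (fun x => h (-x)) = h from funext heven] at h1
    rw [h1]; ring
  rw [hadamardQuot_parity h1]
  ring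

/-- The bilinear map sending `(x, c)` to the linear form `v ↦ ⟪x, v⟫ • c`; it expresses the
derivative of an even function of the norm. -/
noncomputable def innerSmulRight (W : Type*) [NormedAddCommGroup W] [InnerProductSpace ℝ W] :
    W →L[ℝ] ℂ →L[ℝ] (W →L[ℝ] ℂ) :=
  (ContinuousLinearMap.smulRightL ℝ W ℂ).comp (innerSL ℝ)

theorem innerSmulRight_apply (x : W) (c : ℂ) (v : W) :
    innerSmulRight W x c v = ((inner ℝ x v : ℝ) : ℂ) * c := by
  simp [innerSmulRight]

theorem ContDiff.deriv_infty {h : ℝ → ℂ} (hh : ContDiff ℝ ∞ h) : ContDiff ℝ ∞ (deriv h) :=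
  (contDiff_infty_iff_deriv.1 hh).2

theorem hasFDerivAt_comp_norm {h : ℝ → ℂ} (hh : ContDiff ℝ ∞ h) (heven : ∀ r, h (-r) = h r)
    (x : W) : HasFDerivAt (fun x : W => h ‖x‖)
      (innerSmulRight W x (hadamardQuot (deriv h) ‖x‖)) x := by
  have hd0 := deriv_zero_of_even heven
  have hdiv : ∀ r : ℝ, (r : ℂ) * hadamardQuot (deriv h) r = deriv h r := fun r => by
    rw [mul_hadamardQuot hh.deriv_infty, hd0, sub_zero]
  rcases eq_or_ne x 0 with rfl | hx
  · -- Near the origin `h ‖x‖ = h 0 + O(‖x‖ ^ 2)`.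
    obtain ⟨hk, hk2, -⟩ := iterate_hadamardQuot (h := fun r => h r - h 0)
      (hh.sub contDiff_const) 2 (by
        intro k hk
        interval_cases k
        · simp
        · simp [hd0])
    set k := hadamardQuot^[2] (fun r => h r - h 0)
    rw [hasFDerivAt_iff_isLittleO]
    have h1 : (fun x : W => k ‖x‖) =O[nhds 0] (fun _ => (1 : ℝ)) :=
      ((hk.continuous.comp continuous_norm).tendsto (0 : W)).isBigO_one ℝ
    have h2 : (fun x : W => ((‖x‖ : ℝ) : ℂ) ^ 2) =o[nhds 0] (fun x : W => x) := by
      have := Asymptotics.isLittleO_norm_pow_id (E' := W) (n := 2) one_lt_two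
      refine Asymptotics.IsLittleO.congr_left (Asymptotics.IsLittleO.of_norm_left
        (f' := fun x : W => ((‖x‖ : ℝ) : ℂ) ^ 2) ?_) fun _ => rfl
      simpa using this
    have h4 : (fun x : W => h ‖x‖ - h 0) =o[nhds 0] (fun x : W => x) := by
      rw [← Asymptotics.isLittleO_norm_right]
      refine (Asymptotics.IsLittleO.congr (h2.norm_right.mul_isBigO h1) ?_ ?_)
      · exact fun x => hk2 ‖x‖
      · simp
    simpa using h4
  · have h1 : HasFDerivAt (fun x : W => ‖x‖) ((‖x‖⁻¹ : ℝ) • innerSL ℝ x) x := by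
      have h2 := (hasStrictFDerivAt_norm_sq x).hasFDerivAt.sqrt (by simpa using hx)
      simp only [Real.sqrt_sq (norm_nonneg _)] at h2
      convert! h2 using 1
      ext v
      have : ‖x‖ ≠ 0 := norm_ne_zero_iff.2 hx
      simp
      field_simp
    have h3 := (hh.differentiable (by simp) ‖x‖).hasDerivAt.hasFDerivAt.comp x h1
    convert! h3 using 1
    ext v
    have : ((‖x‖ : ℝ) : ℂ) ≠ 0 := by exact_mod_cast norm_ne_zero_iff.2 hx
    rw [innerSmulRight_apply]
    simp [← hdiv]
    field_simp

/-- Whitney's theorem on even functions: a smooth even function of the norm is smooth. Its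
derivative is `x ↦ ⟪x, ·⟫ • q ‖x‖` with `q(r) = h'(r) / r` again smooth and even, so that the order
of differentiability increases by one at each step. -/
theorem contDiff_comp_norm {h : ℝ → ℂ} (hh : ContDiff ℝ ∞ h) (heven : ∀ r, h (-r) = h r) :
    ContDiff ℝ ∞ (fun x : W => h ‖x‖) := by
  rw [contDiff_infty]
  intro n
  induction n generalizing h with
  | zero =>
    rw [Nat.cast_zero, contDiff_zero]
    exact hh.continuous.comp continuous_norm
  | succ n ih =>
    push_cast
    rw [contDiff_succ_iff_hasFDerivAt]
    exact ⟨_, (innerSmulRight W).isBoundedBilinearMap.contDiff.comp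
      (contDiff_id.prodMk (ih (contDiff_hadamardQuot hh.deriv_infty)
        (hadamardQuot_deriv_even heven))), hasFDerivAt_comp_norm hh heven⟩

end Radial

/-! ### Schwartz estimates -/

section Schwartz

variable {V W : Type*} [NormedAddCommGroup V] [NormedSpace ℝ V]

/-- A family of real functions, indexed by the Schwartz functions `f`, is dominated if a single
continuous seminorm of `f` bounds its values. -/
def SchwartzDominated (b : 𝓢(V, ℂ) → W → ℝ) : Prop :=
  ∃ (s : Finset (ℕ × ℕ)) (C : ℝ), 0 ≤ C ∧
    ∀ f x, b f x ≤ C * s.sup (schwartzSeminormFamily ℂ V ℂ) f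

namespace SchwartzDominated

theorem mono {b b' : 𝓢(V, ℂ) → W → ℝ} (hb : SchwartzDominated b) (h : ∀ f x, b' f x ≤ b f x) :
    SchwartzDominated b' :=
  let ⟨s, C, hC, H⟩ := hb
  ⟨s, C, hC, fun f x => (h f x).trans (H f x)⟩

theorem add {b b' : 𝓢(V, ℂ) → W → ℝ} (hb : SchwartzDominated b) (hb' : SchwartzDominated b') :
    SchwartzDominated (fun f x => b f x + b' f x) := by
  obtain ⟨s, C, hC, H⟩ := hb
  obtain ⟨s', C', hC', H'⟩ := hb'
  classical
  refine ⟨s ∪ s', C + C', add_nonneg hC hC', fun f x => ?_⟩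
  have h1 : s.sup (schwartzSeminormFamily ℂ V ℂ) f ≤
    (s ∪ s').sup (schwartzSeminormFamily ℂ V ℂ) f :=
    Finset.sup_mono (f := schwartzSeminormFamily ℂ V ℂ) Finset.subset_union_left f
  have h2 : s'.sup (schwartzSeminormFamily ℂ V ℂ) f ≤
    (s ∪ s').sup (schwartzSeminormFamily ℂ V ℂ) f :=
    Finset.sup_mono (f := schwartzSeminormFamily ℂ V ℂ) Finset.subset_union_right f
  rw [add_mul]
  exact add_le_add ((H f x).trans (mul_le_mul_of_nonneg_left h1 hC))
    ((H' f x).trans (mul_le_mul_of_nonneg_left h2 hC'))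

theorem const_mul {b : 𝓢(V, ℂ) → W → ℝ} (hb : SchwartzDominated b) {c : ℝ} (hc : 0 ≤ c) :
    SchwartzDominated (fun f x => c * b f x) := by
  obtain ⟨s, C, hC, H⟩ := hb
  refine ⟨s, c * C, mul_nonneg hc hC, fun f x => ?_⟩
  rw [mul_assoc]
  exact mul_le_mul_of_nonneg_left (H f x) hc

theorem sum {ι : Type*} {b : ι → 𝓢(V, ℂ) → W → ℝ} (t : Finset ι)
    (hb : ∀ i ∈ t, SchwartzDominated (b i)) :
    SchwartzDominated (fun f x => ∑ i ∈ t, b i f x) := by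
  classical
  induction t using Finset.induction_on with
  | empty => exact ⟨∅, 0, le_rfl, by simp⟩
  | insert i t hi ih =>
    simp only [Finset.sum_insert hi]
    exact (hb i (by simp)).add (ih fun j hj => hb j (by simp [hj]))

end SchwartzDominated

variable [NormedAddCommGroup W] {F : Type*} [NormedAddCommGroup F] [NormedSpace ℝ F]

/-- A family of functions, indexed by the Schwartz functions `f`, is rapidly decreasing if each of
its Schwartz seminorms is bounded by a continuous seminorm of `f`. -/
def RapidlyDecreasing [NormedSpace ℝ W] (T : 𝓢(V, ℂ) → W → F) : Prop :=
  ∀ k n : ℕ, SchwartzDominated fun f x => ‖x‖ ^ k * ‖iteratedFDeriv ℝ n (T f) x‖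

theorem RapidlyDecreasing.deriv {T : 𝓢(V, ℂ) → ℝ → ℂ} (hT : RapidlyDecreasing T) :
    RapidlyDecreasing (fun f => deriv (T f)) := fun k n =>
  (hT k (n + 1)).mono fun f x => by
    simp only [norm_iteratedFDeriv_eq_norm_iteratedDeriv, iteratedDeriv_succ']
    rfl

theorem RapidlyDecreasing.hadamardQuot {T : 𝓢(V, ℂ) → ℝ → ℂ} (hT : RapidlyDecreasing T)
    (hs : ∀ f, ContDiff ℝ ∞ (T f)) (h0 : ∀ f, T f 0 = 0) :
    RapidlyDecreasing (fun f => hadamardQuot (T f)) := by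
  intro k
  induction k with
  | zero =>
    intro n
    obtain ⟨s, C, hC, H⟩ := hT 0 (n + 1)
    refine ⟨s, C, hC, fun f x => ?_⟩
    simp only [pow_zero, one_mul, norm_iteratedFDeriv_eq_norm_iteratedDeriv] at H ⊢
    exact norm_iteratedDeriv_hadamardQuot_le (hs f) (H f) x
  | succ k ih =>
    intro n
    refine ((hT k n).add ((ih (n - 1)).const_mul n.cast_nonneg)).mono fun f x => ?_
    simp only [norm_iteratedFDeriv_eq_norm_iteratedDeriv]
    have h1 := mul_iteratedDeriv_hadamardQuot (hs f) (h0 f) n x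
    have h2 : ‖x‖ * ‖iteratedDeriv n (_root_.hadamardQuot (T f)) x‖ ≤ ‖iteratedDeriv n (T f) x‖ +
        n * ‖iteratedDeriv (n - 1) (_root_.hadamardQuot (T f)) x‖ := by
      rw [← eq_sub_iff_add_eq] at h1
      calc _ = ‖(x : ℂ) * iteratedDeriv n (_root_.hadamardQuot (T f)) x‖ := by
            rw [norm_mul, norm_real]
        _ ≤ _ := by
          rw [h1]
          refine (norm_sub_le _ _).trans_eq ?_
          simp
    calc _ = ‖x‖ ^ k * (‖x‖ * ‖iteratedDeriv n (_root_.hadamardQuot (T f)) x‖) := by ring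
      _ ≤ ‖x‖ ^ k * _ := mul_le_mul_of_nonneg_left h2 (by positivity)
      _ = _ := by ring

theorem RapidlyDecreasing.iterate_hadamardQuot {T : 𝓢(V, ℂ) → ℝ → ℂ} (hT : RapidlyDecreasing T)
    (hs : ∀ f, ContDiff ℝ ∞ (T f)) (m : ℕ) (h0 : ∀ f, ∀ k < m, iteratedDeriv k (T f) 0 = 0) :
    RapidlyDecreasing (fun f => _root_.hadamardQuot^[m] (T f)) := by
  induction m with
  | zero => exact hT
  | succ m ih =>
    have h1 := fun f => _root_.iterate_hadamardQuot (hs f) m fun k hk => h0 f k (by omega)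
    simp only [Function.iterate_succ_apply']
    refine (ih fun f k hk => h0 f k (by omega)).hadamardQuot (fun f => (h1 f).1) fun f => ?_
    simp [(h1 f).2.2, h0 f m (Nat.lt_succ_self m)]

theorem norm_iteratedFDeriv_id_le [NormedSpace ℝ W] (n : ℕ) (x : W) :
    ‖iteratedFDeriv ℝ n (fun x : W => x) x‖ ≤ ‖x‖ + 1 := by
  rcases n with _ | n
  · simp
  · rw [← norm_iteratedFDeriv_fderiv]
    have : fderiv ℝ (fun x : W => x) = fun _ => ContinuousLinearMap.id ℝ W :=
      funext fun x => fderiv_fun_id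
    rw [this]
    rcases n with _ | n
    · simpa using ContinuousLinearMap.norm_id_le.trans (le_add_of_nonneg_left (norm_nonneg x))
    · rw [iteratedFDeriv_succ_const]
      simp
      positivity

set_option maxSynthPendingDepth 5 in
theorem RapidlyDecreasing.comp_norm [InnerProductSpace ℝ W] {T : 𝓢(V, ℂ) → ℝ → ℂ}
    (hT : RapidlyDecreasing T) (hs : ∀ f, ContDiff ℝ ∞ (T f)) (heven : ∀ f r, T f (-r) = T f r) :
    RapidlyDecreasing (fun f (x : W) => T f ‖x‖) := by
  intro k n
  induction n using Nat.strong_induction_on generalizing k T with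
  | _ n ih =>
    rcases n with _ | n
    · obtain ⟨s, C, hC, H⟩ := hT k 0
      refine ⟨s, C, hC, fun f x => ?_⟩
      simpa using H f ‖x‖
    · -- The quotient `q f (r) = (T f)'(r) / r` satisfies the same hypotheses.
      set q : 𝓢(V, ℂ) → ℝ → ℂ := fun f => _root_.hadamardQuot (_root_.deriv (T f)) with hq
      have hqs : ∀ f, ContDiff ℝ ∞ (q f) := fun f => contDiff_hadamardQuot (hs f).deriv_infty
      have hqe : ∀ f r, q f (-r) = q f r := fun f => hadamardQuot_deriv_even (heven f)
      have hqT : RapidlyDecreasing q :=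
        hT.deriv.hadamardQuot (fun f => (hs f).deriv_infty) fun f => deriv_zero_of_even (heven f)
      have key : ∀ i ∈ Finset.range (n + 1), SchwartzDominated fun f (x : W) =>
          ‖innerSmulRight W‖ * n.choose i *
            (‖x‖ ^ (k + 1) * ‖iteratedFDeriv ℝ (n - i) (fun x : W => q f ‖x‖) x‖ +
              ‖x‖ ^ k * ‖iteratedFDeriv ℝ (n - i) (fun x : W => q f ‖x‖) x‖) := fun i _ =>
        ((ih (n - i) (by omega) hqT hqs hqe (k + 1)).add
          (ih (n - i) (by omega) hqT hqs hqe k)).const_mul (by positivity)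
      refine (SchwartzDominated.sum _ key).mono fun f x => ?_
      have h1 : fderiv ℝ (fun x : W => T f ‖x‖) = fun x => innerSmulRight W x (q f ‖x‖) :=
        funext fun x => (hasFDerivAt_comp_norm (hs f) (heven f) x).fderiv
      rw [← norm_iteratedFDeriv_fderiv, h1]
      have h2 := (innerSmulRight W).norm_iteratedFDeriv_le_of_bilinear (n := n) (N := ∞)
        (f := fun x : W => x) (g := fun x : W => q f ‖x‖) contDiff_id
        (contDiff_comp_norm (hqs f) (hqe f)) x (by exact_mod_cast le_top)
      calc _ ≤ ‖x‖ ^ k * _ := mul_le_mul_of_nonneg_left h2 (by positivity)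
        _ ≤ ‖x‖ ^ k * (‖innerSmulRight W‖ * ∑ i ∈ Finset.range (n + 1), n.choose i *
              (‖x‖ + 1) * ‖iteratedFDeriv ℝ (n - i) (fun x : W => q f ‖x‖) x‖) := by
          gcongr
          exact norm_iteratedFDeriv_id_le _ _
        _ = _ := by
          rw [← mul_assoc, Finset.mul_sum]
          exact Finset.sum_congr rfl fun i _ => by ring

end Schwartz

/-! ### Polynomial functions and their derivatives -/

section Poly

variable {d : ℕ}

/-- The polynomial function on `ℝ^d` defined by a polynomial with complex coefficients. -/
noncomputable def polyEval (P : MvPolynomial (Fin d) ℂ) (x : RSpace d) : ℂ :=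
  MvPolynomial.eval (fun i => ((x i : ℝ) : ℂ)) P

theorem hasFDerivAt_polyEval (P : MvPolynomial (Fin d) ℂ) (x : RSpace d) :
    HasFDerivAt (polyEval P) (∑ i, (EuclideanSpace.proj i : RSpace d →L[ℝ] ℝ).smulRight
      (polyEval (MvPolynomial.pderiv i P) x)) x := by
  induction P using MvPolynomial.induction_on with
  | C a =>
    have h1 : polyEval (MvPolynomial.C a : MvPolynomial (Fin d) ℂ) = fun _ => a := by
      ext; simp [polyEval]
    rw [h1]
    refine (hasFDerivAt_const a x).congr_fderiv ?_
    ext v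
    simp [polyEval]
  | add p q hp hq =>
    have h1 : polyEval (p + q) = polyEval p + polyEval q := by ext; simp [polyEval]
    rw [h1]
    refine (hp.add hq).congr_fderiv ?_
    ext v
    simp [polyEval, Finset.sum_add_distrib]
  | mul_X p j hp =>
    have h1 : HasFDerivAt (fun x : RSpace d => ((x j : ℝ) : ℂ))
        (ofRealCLM.comp (EuclideanSpace.proj j : RSpace d →L[ℝ] ℝ)) x :=
      (ofRealCLM.comp (EuclideanSpace.proj j : RSpace d →L[ℝ] ℝ)).hasFDerivAt
    have h3 : polyEval (p * MvPolynomial.X j) =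
        polyEval p * fun x : RSpace d => ((x j : ℝ) : ℂ) := by
      ext; simp [polyEval]
    rw [h3]
    refine (hp.mul h1).congr_fderiv ?_
    ext v
    simp only [Derivation.leibniz, MvPolynomial.pderiv_X, smul_eq_mul, polyEval, map_add, map_mul,
      MvPolynomial.eval_X, Pi.single_apply, sum_apply, add_apply,
      smul_apply, ContinuousLinearMap.smulRight_apply, real_smul, mul_add,
      Finset.sum_add_distrib, Finset.mul_sum]
    congr 1
    · rw [Finset.sum_eq_single j]
      · simp; ring
      · intro i _ hij
        simp [hij.symm]
      · simp
    · exact Finset.sum_congr rfl fun i _ => by simp; ring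

theorem fderiv_polyEval_single (P : MvPolynomial (Fin d) ℂ) (x : RSpace d) (i : Fin d) :
    fderiv ℝ (polyEval P) x (EuclideanSpace.single i 1) = polyEval (MvPolynomial.pderiv i P) x := by
  rw [(hasFDerivAt_polyEval P x).fderiv, sum_apply, Finset.sum_eq_single i]
  · simp
  · intro j _ hij
    simp [hij]
  · simp

theorem differentiable_polyEval (P : MvPolynomial (Fin d) ℂ) : Differentiable ℝ (polyEval P) :=
  fun x => (hasFDerivAt_polyEval P x).differentiableAt

theorem continuous_polyEval (P : MvPolynomial (Fin d) ℂ) : Continuous (polyEval P) :=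
  (differentiable_polyEval P).continuous

theorem polyEval_smul {P : MvPolynomial (Fin d) ℂ} {m : ℕ} (hP : P.IsHomogeneous m) (r : ℝ)
    (x : RSpace d) : polyEval P (r • x) = (r : ℂ) ^ m * polyEval P x := by
  simp only [polyEval, MvPolynomial.eval_eq', Finset.mul_sum]
  refine Finset.sum_congr rfl fun α hα => ?_
  have h1 : ∑ i, α i = m := by
    rw [← Finsupp.degree_eq_sum, Finsupp.degree_eq_weight_one]
    exact hP (MvPolynomial.mem_support_iff.1 hα)
  simp only [PiLp.smul_apply, smul_eq_mul, ofReal_mul, mul_pow, Finset.prod_mul_distrib,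
    Finset.prod_pow_eq_pow_sum, h1]
  ring

theorem eq_zero_of_polyEval_eq_zero {P : MvPolynomial (Fin d) ℂ} (h : ∀ x, polyEval P x = 0) :
    P = 0 := by
  refine MvPolynomial.funext_set (fun _ => Set.range ((↑) : ℝ → ℂ))
    (fun _ => Set.infinite_range_of_injective ofReal_injective) fun x hx => ?_
  choose y hy using fun i => hx i (Set.mem_univ i)
  have := h (WithLp.toLp 2 y)
  simpa [polyEval, hy] using this

/-- The Laplacian of a polynomial. -/
noncomputable def polyLaplacian (P : MvPolynomial (Fin d) ℂ) : MvPolynomial (Fin d) ℂ :=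
  ∑ i, MvPolynomial.pderiv i (MvPolynomial.pderiv i P)

theorem polyLaplacian_pderiv (P : MvPolynomial (Fin d) ℂ) (j : Fin d) :
    polyLaplacian (MvPolynomial.pderiv j P) = MvPolynomial.pderiv j (polyLaplacian P) := by
  simp only [polyLaplacian, map_sum]
  refine Finset.sum_congr rfl fun i _ => ?_
  have hc : ∀ Q : MvPolynomial (Fin d) ℂ, MvPolynomial.pderiv i (MvPolynomial.pderiv j Q) =
    MvPolynomial.pderiv j (MvPolynomial.pderiv i Q) := fun Q => by
    induction Q using MvPolynomial.induction_on with
    | C a => simp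
    | add p q hp hq => simp [hp, hq]
    | mul_X p k hp =>
      simp only [Derivation.leibniz, MvPolynomial.pderiv_X, map_add, smul_eq_mul, hp,
        Pi.single_apply, apply_ite, map_zero, Derivation.map_one_eq_zero, mul_zero]
      split_ifs <;> ring
  rw [hc, hc]

theorem polyLaplacian_eq_zero {P : MvPolynomial (Fin d) ℂ}
    (h : InnerProductSpace.HarmonicOnNhd (polyEval P) Set.univ) : polyLaplacian P = 0 := by
  refine eq_zero_of_polyEval_eq_zero fun x => ?_
  have h1 := (h x (Set.mem_univ x)).2.self_of_nhds
  rw [congrFun (InnerProductSpace.laplacian_eq_iteratedFDeriv_orthonormalBasis (polyEval P)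
    (EuclideanSpace.basisFun (Fin d) ℝ)) x] at h1
  simp only [polyLaplacian]
  rw [polyEval, map_sum]
  refine Eq.trans (Finset.sum_congr rfl fun i _ => ?_) h1
  rw [iteratedFDeriv_two_apply]
  simp only [EuclideanSpace.basisFun_apply, Matrix.cons_val_zero, Matrix.cons_val_one]
  have h2 : fderiv ℝ (fun y => fderiv ℝ (polyEval P) y (EuclideanSpace.single i 1)) x
    (EuclideanSpace.single i 1) = polyEval (MvPolynomial.pderiv i (MvPolynomial.pderiv i P)) x := by
    simp only [fderiv_polyEval_single]
  rw [← polyEval, ← h2, fderiv_clm_apply]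
  · simp
  · exact ((h x (Set.mem_univ x)).1.fderiv_right (m := 1) (by norm_num)).differentiableAt
      (by simp)
  · fun_prop

end Poly

/-! ### Gaussian integrals of harmonic polynomials -/

section Gauss

variable {d : ℕ}

/-- The Gaussian `e^{-π t |x|²}`. -/
noncomputable def gauss {p : ℕ} (t : ℝ) (x : RSpace p) : ℂ := cexp (-(Real.pi * t : ℝ) * ‖x‖ ^ 2)

/-- The modulated Gaussian `e^{-π t |x|²} e^{-2π i ξ·x}`. -/
noncomputable def gaussWave (t : ℝ) (ξ x : RSpace d) : ℂ :=
  cexp (-(Real.pi * t : ℝ) * ‖x‖ ^ 2 + -(2 * Real.pi * I) * inner ℝ ξ x)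

theorem gaussWave_zero (t : ℝ) (x : RSpace d) : gaussWave t 0 x = gauss t x := by
  simp [gaussWave, gauss]

theorem continuous_gauss {p : ℕ} (t : ℝ) : Continuous (gauss t : RSpace p → ℂ) := by
  unfold gauss
  fun_prop

theorem norm_gauss {p : ℕ} (t : ℝ) (x : RSpace p) :
    ‖gauss t x‖ = Real.exp (-(Real.pi * t) * ‖x‖ ^ 2) := by
  rw [gauss, norm_exp]
  congr 1
  have : -((Real.pi * t : ℝ) : ℂ) * (‖x‖ : ℂ) ^ 2 = ((-(Real.pi * t) * ‖x‖ ^ 2 : ℝ) : ℂ) := by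
    push_cast; ring
  rw [this, ofReal_re]

theorem gaussWave_add (s t : ℝ) (ξ x : RSpace d) :
    gaussWave (s + t) ξ x = gaussWave s ξ x * gauss t x := by
  rw [gaussWave, gaussWave, gauss, ← Complex.exp_add]
  congr 1
  push_cast
  ring

theorem integrable_gaussWave {t : ℝ} (ht : 0 < t) (ξ : RSpace d) : Integrable (gaussWave t ξ) :=
  GaussianFourier.integrable_cexp_neg_mul_sq_norm_add (b := (Real.pi * t : ℝ))
    (by rw [ofReal_re]; positivity) _ ξ

theorem integrable_gauss {p : ℕ} {t : ℝ} (ht : 0 < t) :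
    Integrable (gauss t : RSpace p → ℂ) := by
  have := integrable_gaussWave ht (0 : RSpace p)
  simpa only [funext (gaussWave_zero t)] using this

theorem norm_coord_mul_gauss_le {t : ℝ} (ht : 0 < t) (i : Fin d) (x : RSpace d) :
    ‖((x i : ℝ) : ℂ) * gauss t x‖ ≤ 1 + 1 / (Real.pi * t) := by
  have ha : 0 < Real.pi * t := by positivity
  rw [norm_mul, norm_gauss, norm_real]
  set y := ‖x‖
  have hy : 0 ≤ y := norm_nonneg x
  have h1 : ‖x i‖ ≤ y := PiLp.norm_apply_le x i
  have h2 : Real.exp (-(Real.pi * t) * y ^ 2) ≤ 1 / (1 + Real.pi * t * y ^ 2) := by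
    rw [neg_mul, Real.exp_neg, ← one_div]
    exact one_div_le_one_div_of_le (by positivity)
      (by linarith [Real.add_one_le_exp (Real.pi * t * y ^ 2)])
  calc _ ≤ y * (1 / (1 + Real.pi * t * y ^ 2)) := by gcongr
    _ ≤ _ := by
      rw [mul_one_div, div_le_iff₀ (by positivity)]
      have h3 : 1 / (Real.pi * t) * (Real.pi * t * y ^ 2) = y ^ 2 := by field_simp
      have h4 : 0 ≤ Real.pi * t * y ^ 2 := by positivity
      have h5 : 0 ≤ 1 / (Real.pi * t) := by positivity
      nlinarith [sq_nonneg (y - 1 / 2)]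

theorem integrable_polyEval_mul_gaussWave (P : MvPolynomial (Fin d) ℂ) {t : ℝ} (ht : 0 < t)
    (ξ : RSpace d) : Integrable (fun x => polyEval P x * gaussWave t ξ x) := by
  induction P using MvPolynomial.induction_on generalizing t with
  | C a => simpa [polyEval] using (integrable_gaussWave ht ξ).const_mul a
  | add p q hp hq =>
    refine ((hp ht).add (hq ht)).congr (Filter.Eventually.of_forall fun x => ?_)
    simp [polyEval, add_mul]
  | mul_X p i hp =>
    -- One half of the Gaussian absorbs the additional factor `x i`.
    have h1 := (hp (half_pos ht)).bdd_mul (c := 1 + 1 / (Real.pi * (t / 2)))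
      (f := fun x : RSpace d => ((x i : ℝ) : ℂ) * gauss (t / 2) x)
      (by
        have := continuous_gauss (p := d) (t / 2)
        exact Continuous.aestronglyMeasurable (by fun_prop))
      (Filter.Eventually.of_forall (norm_coord_mul_gauss_le (half_pos ht) i))
    refine h1.congr (Filter.Eventually.of_forall fun x => ?_)
    have h2 := gaussWave_add (t / 2) (t / 2) ξ x
    rw [add_halves] at h2
    simp only [h2, polyEval, map_mul, MvPolynomial.eval_X]
    ring

/-- The integral of a polynomial against a modulated Gaussian, as a linear form. -/
noncomputable def gaussWaveIntegral {t : ℝ} (ht : 0 < t) (ξ : RSpace d) :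
    MvPolynomial (Fin d) ℂ →ₗ[ℂ] ℂ where
  toFun P := ∫ x, polyEval P x * gaussWave t ξ x
  map_add' P Q := by
    rw [← integral_add (integrable_polyEval_mul_gaussWave P ht ξ)
      (integrable_polyEval_mul_gaussWave Q ht ξ)]
    simp [polyEval, add_mul]
  map_smul' c P := by
    rw [RingHom.id_apply, smul_eq_mul, ← integral_const_mul]
    simp [polyEval, MvPolynomial.smul_eval, mul_assoc]

theorem gaussWaveIntegral_apply {t : ℝ} (ht : 0 < t) (ξ : RSpace d) (P : MvPolynomial (Fin d) ℂ) :
    gaussWaveIntegral ht ξ P = ∫ x, polyEval P x * gaussWave t ξ x := rfl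

theorem hasFDerivAt_gaussWave (t : ℝ) (ξ x : RSpace d) :
    HasFDerivAt (gaussWave t ξ) (gaussWave t ξ x •
      (-(Real.pi * t : ℝ) • (2 • ofRealCLM.comp (innerSL ℝ x)) +
        (-(2 * Real.pi * I)) • ofRealCLM.comp (innerSL ℝ ξ))) x := by
  have h1 : HasFDerivAt (fun x : RSpace d => (‖x‖ : ℂ) ^ 2)
      (2 • ofRealCLM.comp (innerSL ℝ x)) x := by
    have := ofRealCLM.hasFDerivAt.comp x (hasStrictFDerivAt_norm_sq x).hasFDerivAt
    refine (this.congr_fderiv ?_).congr_of_eventuallyEq (Filter.Eventually.of_forall fun y => ?_)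
    · ext v; simp
    · simp
  have h2 : HasFDerivAt (fun x : RSpace d => ((inner ℝ ξ x : ℝ) : ℂ))
      (ofRealCLM.comp (innerSL ℝ ξ)) x := (ofRealCLM.comp (innerSL ℝ ξ)).hasFDerivAt
  have h3 := ((h1.const_mul (-(Real.pi * t : ℝ) : ℂ)).add (h2.const_mul (-(2 * Real.pi * I)))).cexp
  refine h3.congr_fderiv ?_
  ext v
  simp [gaussWave]

theorem fderiv_gaussWave_single (t : ℝ) (ξ x : RSpace d) (i : Fin d) :
    fderiv ℝ (gaussWave t ξ) x (EuclideanSpace.single i 1) =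
      (-(2 * Real.pi * t) * (x i : ℝ) - 2 * Real.pi * I * (ξ i : ℝ)) * gaussWave t ξ x := by
  rw [(hasFDerivAt_gaussWave t ξ x).fderiv]
  simp [EuclideanSpace.inner_single_right]
  ring

/-- Integration by parts against a Gaussian. -/
theorem gaussWaveIntegral_X_mul {t : ℝ} (ht : 0 < t) (ξ : RSpace d) (i : Fin d)
    (P : MvPolynomial (Fin d) ℂ) :
    (2 * Real.pi * t : ℂ) * gaussWaveIntegral ht ξ (MvPolynomial.X i * P) =
      gaussWaveIntegral ht ξ (MvPolynomial.pderiv i P) -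
        2 * Real.pi * I * (ξ i : ℝ) * gaussWaveIntegral ht ξ P := by
  have h0 : ∀ x, polyEval P x * fderiv ℝ (gaussWave t ξ) x (EuclideanSpace.single i 1) =
      -(2 * Real.pi * t) * (polyEval (MvPolynomial.X i * P) x * gaussWave t ξ x) -
        2 * Real.pi * I * (ξ i : ℝ) * (polyEval P x * gaussWave t ξ x) := fun x => by
    rw [fderiv_gaussWave_single]
    simp only [polyEval, map_mul, MvPolynomial.eval_X]
    ring
  have hi1 := (integrable_polyEval_mul_gaussWave (MvPolynomial.X i * P) ht ξ).const_mul
    (-(2 * Real.pi * t) : ℂ)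
  have hi2 := (integrable_polyEval_mul_gaussWave P ht ξ).const_mul
    (2 * Real.pi * I * (ξ i : ℝ) : ℂ)
  have h1 := integral_mul_fderiv_eq_neg_fderiv_mul_of_integrable (μ := volume)
    (f := polyEval P) (g := gaussWave t ξ) (v := EuclideanSpace.single i 1)
    (by simpa only [fderiv_polyEval_single] using
      integrable_polyEval_mul_gaussWave (MvPolynomial.pderiv i P) ht ξ)
    (by simp only [h0]; exact hi1.sub hi2)
    (integrable_polyEval_mul_gaussWave P ht ξ)
    (fun x _ => differentiable_polyEval P x)
    (fun x _ => (hasFDerivAt_gaussWave t ξ x).differentiableAt)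
  simp only [h0, fderiv_polyEval_single] at h1
  rw [integral_sub hi1 hi2, integral_const_mul, integral_const_mul] at h1
  simp only [gaussWaveIntegral_apply]
  linear_combination -h1

/-- Euler's identity `m P = ∑ x_i ∂_i P`, integration by parts, and harmonicity of `P` reduce the
Gaussian integral of `Q P` to integrals in which the degree of `P` is lower. -/
theorem euler_gaussWaveIntegral {t : ℝ} (ht : 0 < t) (ξ : RSpace d) {m : ℕ}
    {P : MvPolynomial (Fin d) ℂ} (hP : P.IsHomogeneous m) (hΔ : polyLaplacian P = 0)
    (Q : MvPolynomial (Fin d) ℂ) :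
    (2 * Real.pi * t : ℂ) * (m * gaussWaveIntegral ht ξ (Q * P)) =
      ∑ i, (gaussWaveIntegral ht ξ (MvPolynomial.pderiv i Q * MvPolynomial.pderiv i P) -
        2 * Real.pi * I * (ξ i : ℝ) * gaussWaveIntegral ht ξ (Q * MvPolynomial.pderiv i P)) := by
  have h1 : (m : ℂ) * gaussWaveIntegral ht ξ (Q * P) =
      ∑ i, gaussWaveIntegral ht ξ (MvPolynomial.X i * (Q * MvPolynomial.pderiv i P)) := by
    rw [← map_sum, ← smul_eq_mul, ← map_smul]
    congr 1
    have h2 : ((m : ℂ) • (Q * P)) = Q * (m • P) := by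
      rw [Nat.cast_smul_eq_nsmul, mul_smul_comm]
    rw [h2, ← hP.sum_X_mul_pderiv, Finset.mul_sum]
    exact Finset.sum_congr rfl fun i _ => by ring
  have h3 : ∑ i, gaussWaveIntegral ht ξ
      (Q * MvPolynomial.pderiv i (MvPolynomial.pderiv i P)) = 0 := by
    rw [← map_sum, ← Finset.mul_sum]
    have : ∑ i, MvPolynomial.pderiv i (MvPolynomial.pderiv i P) = 0 := hΔ
    rw [this, mul_zero, map_zero]
  rw [h1, Finset.mul_sum, ← sub_eq_zero, ← Finset.sum_sub_distrib, ← h3]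
  refine Finset.sum_congr rfl fun i _ => ?_
  rw [gaussWaveIntegral_X_mul, Derivation.leibniz, map_add]
  simp only [smul_eq_mul]
  rw [mul_comm (MvPolynomial.pderiv i P) (MvPolynomial.pderiv i Q)]
  ring

/-- A harmonic homogeneous polynomial is orthogonal, with respect to Gaussian measure, to the
homogeneous polynomials of lower degree. -/
theorem gaussWaveIntegral_mul_eq_zero {t : ℝ} (ht : 0 < t) {k m : ℕ} (hkm : k < m)
    {P Q : MvPolynomial (Fin d) ℂ} (hP : P.IsHomogeneous m) (hΔ : polyLaplacian P = 0)
    (hQ : Q.IsHomogeneous k) : gaussWaveIntegral ht 0 (Q * P) = 0 := by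
  induction k generalizing m P Q with
  | zero =>
    have h1 := euler_gaussWaveIntegral ht 0 hP hΔ Q
    rw [← MvPolynomial.totalDegree_zero_iff_isHomogeneous,
      MvPolynomial.totalDegree_eq_zero_iff_eq_C] at hQ
    rw [hQ] at h1 ⊢
    have hm : (m : ℂ) ≠ 0 := by exact_mod_cast hkm.ne'
    have ht' : (t : ℂ) ≠ 0 := by exact_mod_cast ht.ne'
    simpa [hm, ht', Real.pi_ne_zero] using h1
  | succ k ih =>
    have h1 := euler_gaussWaveIntegral ht 0 hP hΔ Q
    have h2 : ∀ i, gaussWaveIntegral ht 0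
        (MvPolynomial.pderiv i Q * MvPolynomial.pderiv i P) = 0 := fun i =>
      ih (m := m - 1) (by omega) hP.pderiv (by rw [polyLaplacian_pderiv, hΔ, map_zero]) hQ.pderiv
    have hm : (m : ℂ) ≠ 0 := by exact_mod_cast (by omega : m ≠ 0)
    have ht' : (t : ℂ) ≠ 0 := by exact_mod_cast ht.ne'
    simpa [hm, ht', Real.pi_ne_zero, h2] using h1

/-- Hecke's identity: the Fourier transform of a harmonic homogeneous polynomial times a Gaussian
is of the same form. -/
theorem gaussWaveIntegral_harmonic {t : ℝ} (ht : 0 < t) (ξ : RSpace d) {m : ℕ}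
    {P : MvPolynomial (Fin d) ℂ} (hP : P.IsHomogeneous m) (hΔ : polyLaplacian P = 0) :
    gaussWaveIntegral ht ξ P = (-I / t) ^ m * polyEval P ξ * gaussWaveIntegral ht ξ 1 := by
  induction m generalizing P with
  | zero =>
    rw [← MvPolynomial.totalDegree_zero_iff_isHomogeneous,
      MvPolynomial.totalDegree_eq_zero_iff_eq_C] at hP
    rw [hP, ← mul_one (MvPolynomial.C _), ← MvPolynomial.smul_eq_C_mul, map_smul]
    simp [polyEval]
  | succ m ih =>
    have h1 := euler_gaussWaveIntegral ht ξ hP hΔ 1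
    have h2 := fun i => ih (P := MvPolynomial.pderiv i P) hP.pderiv
      (by rw [polyLaplacian_pderiv, hΔ, map_zero])
    have h3 : ∑ i, ((ξ i : ℝ) : ℂ) * polyEval (MvPolynomial.pderiv i P) ξ =
        (m + 1) * polyEval P ξ := by
      have := congrArg (fun R => polyEval R ξ) hP.sum_X_mul_pderiv
      simpa [polyEval] using this
    have hm : (m : ℂ) + 1 ≠ 0 := by exact_mod_cast Nat.succ_ne_zero m
    have ht' : (t : ℂ) ≠ 0 := by exact_mod_cast ht.ne'
    have hpi : (Real.pi : ℂ) ≠ 0 := by exact_mod_cast Real.pi_ne_zero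
    simp only [one_mul, h2, Derivation.map_one_eq_zero, zero_mul, map_zero, zero_sub,
      Finset.sum_neg_distrib] at h1
    have h4 : ∑ i, 2 * Real.pi * I * (ξ i : ℝ) * ((-I / t) ^ m *
        polyEval (MvPolynomial.pderiv i P) ξ * gaussWaveIntegral ht ξ 1) =
        2 * Real.pi * I * (-I / t) ^ m * ((m + 1) * polyEval P ξ) *
          gaussWaveIntegral ht ξ 1 := by
      rw [← h3, Finset.mul_sum, Finset.sum_mul]
      exact Finset.sum_congr rfl fun i _ => by ring
    rw [h4] at h1
    have h5 : (2 * Real.pi * t * (m + 1) : ℂ) ≠ 0 := by simp [ht', hm, hpi]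
    refine mul_left_cancel₀ h5 ?_
    rw [pow_succ]
    push_cast at h1
    field_simp at h1 ⊢
    linear_combination h1

end Gauss

/-! ### The sphere -/

section Sphere

variable {d : ℕ}

theorem nontrivial_rSpace (hd : 0 < d) : Nontrivial (RSpace d) :=
  Module.nontrivial_of_finrank_pos (R := ℝ) (by simpa using hd)

theorem toSphere_univ_ne_zero (hd : 0 < d) :
    (volume : Measure (RSpace d)).toSphere Set.univ ≠ 0 := by
  have := nontrivial_rSpace hd
  rw [Measure.measure_univ_ne_zero]
  exact Measure.toSphere_ne_zero _

theorem isProbabilityMeasure_sphereProb (hd : 0 < d) : IsProbabilityMeasure (sphereProb d) :=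
  ⟨by
    rw [sphereProb, Measure.smul_apply, smul_eq_mul]
    exact ENNReal.inv_mul_cancel (toSphere_univ_ne_zero hd) (measure_ne_top _ _)⟩

theorem toSphere_eq_smul_sphereProb (hd : 0 < d) :
    (volume : Measure (RSpace d)).toSphere =
      (volume : Measure (RSpace d)).toSphere Set.univ • sphereProb d := by
  rw [sphereProb, smul_smul, ENNReal.mul_inv_cancel (toSphere_univ_ne_zero hd)
    (measure_ne_top _ _), one_smul]

theorem measurePreserving_neg_sphereProb (d : ℕ) :
    MeasurePreserving (fun ζ : USphere d => -ζ) (sphereProb d) (sphereProb d) := by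
  have hm : Measurable (fun ζ : USphere d => -ζ) := continuous_neg.measurable
  refine MeasurePreserving.smul_measure ⟨hm, ?_⟩ _
  ext s hs
  rw [Measure.map_apply hm hs, Measure.toSphere_apply' _ hs, Measure.toSphere_apply' _ (hm hs)]
  congr 1
  rw [← Measure.measure_neg]
  congr 1
  ext x
  simp only [Set.mem_neg, Set.mem_smul, Set.mem_image, Set.mem_preimage]
  constructor
  · rintro ⟨r, hr, _, ⟨ζ, hζ, rfl⟩, h⟩
    exact ⟨r, hr, _, ⟨-ζ, hζ, rfl⟩, by simp [h]⟩
  · rintro ⟨r, hr, _, ⟨ζ, hζ, rfl⟩, h⟩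
    exact ⟨r, hr, _, ⟨-ζ, by simpa using hζ, rfl⟩, by simp [h]⟩

theorem integral_neg_sphereProb (g : USphere d → ℂ) :
    ∫ ζ, g (-ζ) ∂(sphereProb d) = ∫ ζ, g ζ ∂(sphereProb d) :=
  (measurePreserving_neg_sphereProb d).integral_comp
    (Homeomorph.neg (USphere d)).measurableEmbedding g

/-- Integration in polar coordinates. -/
theorem integral_eq_integral_sphereProb (hd : 0 < d) {F : RSpace d → ℂ} (hF : Integrable F) :
    ∫ x, F x = (volume : Measure (RSpace d)).toSphere.real Set.univ *
      ∫ r in Set.Ioi (0 : ℝ), (r : ℂ) ^ (d - 1) * ∫ ζ : USphere d, F (r • (ζ : RSpace d))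
        ∂(sphereProb d) := by
  have := nontrivial_rSpace hd
  set μ : Measure (RSpace d) := volume
  have hmp := μ.measurePreserving_homeomorphUnitSphereProd
  have hemb := (homeomorphUnitSphereProd (RSpace d)).measurableEmbedding
  rw [show Module.finrank ℝ (RSpace d) = d by simp] at hmp
  set F' : USphere d × Set.Ioi (0 : ℝ) → ℂ := fun q => F ((q.2 : ℝ) • (q.1 : RSpace d))
  have hF' : ∀ x : ({0}ᶜ : Set (RSpace d)), F' (homeomorphUnitSphereProd (RSpace d) x) = F x := by
    intro x
    have := congrArg Subtype.val ((homeomorphUnitSphereProd (RSpace d)).symm_apply_apply x)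
    rw [homeomorphUnitSphereProd_symm_apply_coe] at this
    exact congrArg F this
  have hint : Integrable F' (μ.toSphere.prod (Measure.volumeIoiPow (d - 1))) := by
    rw [← hmp.integrable_comp_emb hemb]
    have : F' ∘ homeomorphUnitSphereProd (RSpace d) = F ∘ Subtype.val := funext hF'
    rw [this, ← integrableOn_iff_comap_subtypeVal (measurableSet_singleton _).compl]
    exact hF.integrableOn
  calc ∫ x, F x ∂μ = ∫ x : ({(0)}ᶜ : Set (RSpace d)), F x.1 ∂(μ.comap (↑)) := by
        rw [integral_subtype_comap (measurableSet_singleton _).compl F,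
          restrict_compl_singleton]
    _ = ∫ q, F' q ∂μ.toSphere.prod (.volumeIoiPow (d - 1)) := by
        rw [← hmp.integral_comp hemb]
        simp only [hF']
    _ = ∫ r, ∫ ζ, F' (ζ, r) ∂μ.toSphere ∂(Measure.volumeIoiPow (d - 1)) :=
        integral_prod_symm _ hint
    _ = _ := by
        have h1 : ∀ r, ∫ ζ, F' (ζ, r) ∂μ.toSphere =
            μ.toSphere.real Set.univ * ∫ ζ, F' (ζ, r) ∂sphereProb d := fun r => by
          rw [toSphere_eq_smul_sphereProb hd, integral_smul_measure]
          have := isProbabilityMeasure_sphereProb hd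
          simp [Measure.real]
        simp only [h1]
        rw [integral_const_mul, Measure.volumeIoiPow]
        congr 1
        simp only [ENNReal.ofReal]
        rw [integral_withDensity_eq_integral_smul
          (measurable_subtype_coe.pow_const _).real_toNNReal,
          integral_subtype_comap measurableSet_Ioi fun a : ℝ => Real.toNNReal (a ^ (d - 1)) •
            ∫ ζ : USphere d, F (a • (ζ : RSpace d)) ∂(sphereProb d)]
        refine setIntegral_congr_fun measurableSet_Ioi fun r hr => ?_
        have hr : 0 < r := hr
        simp only [NNReal.smul_def, Real.coe_toNNReal _ (pow_nonneg hr.le _), real_smul, ofReal_pow]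

theorem integral_Ioi_pow_mul_exp_pos (N : ℕ) :
    0 < ∫ r in Set.Ioi (0 : ℝ), r ^ N * Real.exp (-Real.pi * r ^ 2) := by
  have h := integral_rpow_mul_exp_neg_mul_rpow (p := 2) (q := N) (b := Real.pi) two_pos
    (by have : (0 : ℝ) ≤ N := N.cast_nonneg
        linarith) Real.pi_pos
  have h2 : (0 : ℝ) < (N + 1) / 2 := by positivity
  have h3 := Real.Gamma_pos_of_pos h2
  simp only [Real.rpow_natCast, Real.rpow_ofNat] at h
  rw [h]
  have := Real.pi_pos
  positivity

/-- A harmonic homogeneous polynomial is orthogonal on the sphere to the homogeneous polynomials of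
lower degree. -/
theorem integral_sphereProb_mul_eq_zero (hd : 0 < d) {k m : ℕ} (hkm : k < m)
    {P Q : MvPolynomial (Fin d) ℂ} (hP : P.IsHomogeneous m) (hΔ : polyLaplacian P = 0)
    (hQ : Q.IsHomogeneous k) :
    ∫ ζ : USphere d, polyEval Q ζ * polyEval P ζ ∂(sphereProb d) = 0 := by
  -- In polar coordinates the Gaussian integral is the integral over the sphere times a positive
  -- radial integral.
  have h1 := gaussWaveIntegral_mul_eq_zero one_pos hkm hP hΔ hQ
  rw [gaussWaveIntegral_apply, integral_eq_integral_sphereProb hd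
    (integrable_polyEval_mul_gaussWave _ one_pos _)] at h1
  have h2 : ∀ r ∈ Set.Ioi (0 : ℝ), (r : ℂ) ^ (d - 1) * ∫ ζ : USphere d,
      polyEval (Q * P) (r • (ζ : RSpace d)) * gaussWave 1 0 (r • (ζ : RSpace d)) ∂(sphereProb d) =
      ((r ^ (d - 1 + (k + m)) * Real.exp (-Real.pi * r ^ 2) : ℝ) : ℂ) *
        ∫ ζ : USphere d, polyEval Q ζ * polyEval P ζ ∂(sphereProb d) := fun r _ => by
    have h3 : ∀ ζ : USphere d, polyEval (Q * P) (r • (ζ : RSpace d)) *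
        gaussWave 1 0 (r • (ζ : RSpace d)) = (r : ℂ) ^ (k + m) *
          (Real.exp (-Real.pi * r ^ 2) : ℝ) * (polyEval Q ζ * polyEval P ζ) := fun ζ => by
      rw [polyEval_smul (hQ.mul hP), gaussWave_zero, gauss, norm_smul]
      have : ‖(ζ : RSpace d)‖ = 1 := by simp
      rw [this]
      have h4 : (((‖r‖ * 1 : ℝ) : ℂ)) ^ 2 = (r : ℂ) ^ 2 := by
        rw [mul_one, ← ofReal_pow, Real.norm_eq_abs, sq_abs, ofReal_pow]
      rw [h4]
      simp [polyEval]
      ring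
    simp only [h3]
    rw [integral_const_mul]
    push_cast
    ring
  rw [setIntegral_congr_fun measurableSet_Ioi h2, integral_mul_const,
    integral_complex_ofReal] at h1
  have h3 := (integral_Ioi_pow_mul_exp_pos (d - 1 + (k + m))).ne'
  have h4 : (volume : Measure (RSpace d)).toSphere.real Set.univ ≠ 0 := by
    rw [Measure.real, ENNReal.toReal_ne_zero]
    exact ⟨toSphere_univ_ne_zero hd, measure_ne_top _ _⟩
  exact ((mul_eq_zero.1 h1).resolve_left (ofReal_ne_zero.2 h4) |> mul_eq_zero.1).resolve_left
    (ofReal_ne_zero.2 h3)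

end Sphere

/-! ### Taylor coefficients and multi-indices -/

section Taylor

variable {d : ℕ}

theorem hasFDerivAt_iteratedFDeriv_diag {f : RSpace d → ℂ} (hf : ContDiff ℝ ∞ f) (n : ℕ)
    (ζ x : RSpace d) : HasFDerivAt (fun y => iteratedFDeriv ℝ n f y (fun _ => ζ))
      ((ContinuousMultilinearMap.apply ℝ (fun _ : Fin n => RSpace d) ℂ (fun _ => ζ)).comp
        (fderiv ℝ (iteratedFDeriv ℝ n f) x)) x :=
  (ContinuousMultilinearMap.apply ℝ (fun _ : Fin n => RSpace d) ℂ (fun _ => ζ)).hasFDerivAt.comp x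
    (hf.differentiable_iteratedFDeriv (by exact_mod_cast WithTop.coe_lt_top _) x).hasFDerivAt

theorem fderiv_iteratedFDeriv_diag_apply {f : RSpace d → ℂ} (n : ℕ) (ζ x : RSpace d) :
    (ContinuousMultilinearMap.apply ℝ (fun _ : Fin n => RSpace d) ℂ (fun _ => ζ)).comp
        (fderiv ℝ (iteratedFDeriv ℝ n f) x) ζ = iteratedFDeriv ℝ (n + 1) f x (fun _ => ζ) := by
  rw [iteratedFDeriv_succ_apply_left]
  rfl

/-- The space of smooth functions, on which the partial derivatives act as commuting
endomorphisms. -/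
noncomputable def smoothFun (d : ℕ) : Submodule ℂ (RSpace d → ℂ) where
  carrier := {f | ContDiff ℝ ∞ f}
  add_mem' {f g} hf hg :=
    (show ContDiff ℝ ∞ f from hf).add (show ContDiff ℝ ∞ g from hg)
  zero_mem' := show ContDiff ℝ ∞ fun _ => (0 : ℂ) from contDiff_const
  smul_mem' c f hf := (show ContDiff ℝ ∞ f from hf).const_smul c

theorem contDiff_smoothFun (f : smoothFun d) : ContDiff ℝ ∞ f.1 := f.2

theorem partialD_eq {f : RSpace d → ℂ} (hf : ContDiff ℝ ∞ f) (i : Fin d) :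
    partialD i f = fun x => fderiv ℝ f x (EuclideanSpace.single i 1) :=
  funext fun x => (hf.differentiable (by simp) x).lineDeriv_eq_fderiv

/-- The directional derivative as an endomorphism of the space of smooth functions. -/
noncomputable def dirDeriv (v : RSpace d) : Module.End ℂ (smoothFun d) where
  toFun f := ⟨fun x => fderiv ℝ f.1 x v,
    ((contDiff_smoothFun f).fderiv_right (m := ∞) (by simp)).clm_apply contDiff_const⟩
  map_add' f g := by
    ext x
    have hf := contDiff_smoothFun f
    have hg := contDiff_smoothFun g
    simp [fderiv_add (hf.differentiable (by simp) x) (hg.differentiable (by simp) x)]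
  map_smul' c f := by
    ext x
    have hf := contDiff_smoothFun f
    simp [fderiv_const_smul (hf.differentiable (by simp) x) c]

theorem dirDeriv_commute (v w : RSpace d) : Commute (dirDeriv v) (dirDeriv w) := by
  refine LinearMap.ext fun f => Subtype.ext (funext fun x => ?_)
  have hf := contDiff_smoothFun f
  have hd : DifferentiableAt ℝ (fderiv ℝ f.1) x :=
    (hf.fderiv_right (m := ∞) (by simp)).differentiable (by simp) x
  have h1 : ∀ a b : RSpace d, fderiv ℝ (fun y => fderiv ℝ f.1 y a) x b =
      fderiv ℝ (fderiv ℝ f.1) x b a := fun a b => by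
    rw [fderiv_clm_apply hd (differentiableAt_const a)]
    simp
  have h2 := (hf.contDiffAt (x := x)).isSymmSndFDerivAt (by
    rw [minSmoothness_of_isRCLikeNormedField]
    exact ENat.LEInfty.out)
  change fderiv ℝ (fun y => fderiv ℝ f.1 y w) x v = fderiv ℝ (fun y => fderiv ℝ f.1 y v) x w
  rw [h1, h1]
  exact h2.eq v w

theorem dirDeriv_eq_sum (ζ : RSpace d) :
    dirDeriv ζ = ∑ i, ((ζ i : ℝ) : ℂ) • dirDeriv (EuclideanSpace.single i (1 : ℝ)) := by
  ext f x
  have h1 : ζ = ∑ i, ζ i • EuclideanSpace.single i (1 : ℝ) := by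
    ext j
    simp [Pi.single_apply]
  have h2 : fderiv ℝ f.1 x ζ =
      ∑ i, ((ζ i : ℝ) : ℂ) * fderiv ℝ f.1 x (EuclideanSpace.single i 1) := by
    conv_lhs => rw [h1]
    simp
  simpa [dirDeriv] using h2

theorem dirDeriv_pow_apply (ζ : RSpace d) (n : ℕ) (f : smoothFun d) (x : RSpace d) :
    ((dirDeriv ζ ^ n) f).1 x = iteratedFDeriv ℝ n f.1 x (fun _ => ζ) := by
  induction n generalizing x with
  | zero => simp
  | succ n ih =>
    rw [pow_succ']
    change fderiv ℝ ((dirDeriv ζ ^ n) f).1 x ζ = _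
    rw [funext ih, (hasFDerivAt_iteratedFDeriv_diag (contDiff_smoothFun f) n ζ x).fderiv]
    exact fderiv_iteratedFDeriv_diag_apply n ζ x

theorem multiD_eq_prod (α : Fin d → ℕ) (f : smoothFun d) :
    multiD α f.1 = (((List.finRange d).map fun i =>
      dirDeriv (EuclideanSpace.single i (1 : ℝ)) ^ α i).prod f).1 := by
  have h1 : ∀ (i : Fin d) (n : ℕ) (g : smoothFun d), (partialD i)^[n] g.1 =
      ((dirDeriv (EuclideanSpace.single i (1 : ℝ)) ^ n) g).1 := fun i n g => by
    induction n with
    | zero => rfl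
    | succ n ih =>
      rw [Function.iterate_succ_apply', ih, partialD_eq (contDiff_smoothFun _), pow_succ']
      rfl
  unfold multiD
  induction List.finRange d with
  | nil => rfl
  | cons i l ih =>
    rw [List.foldr_cons, ih, h1, List.map_cons, List.prod_cons]
    rfl

open Classical in
/-- The multinomial expansion of the diagonal of the `n`-th derivative: the multinomial theorem in
the ring generated by the commuting operators `∂_i`. -/
theorem iteratedFDeriv_diag_eq_sum {f : RSpace d → ℂ} (hf : ContDiff ℝ ∞ f) (n : ℕ)
    (ζ x : RSpace d) : iteratedFDeriv ℝ n f x (fun _ => ζ) =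
      ∑ α ∈ Finset.piAntidiag (Finset.univ : Finset (Fin d)) n,
        (Nat.multinomial Finset.univ α : ℂ) * (multiD α f x * ((∏ i, ζ i ^ α i : ℝ) : ℂ)) := by
  have h1 := dirDeriv_pow_apply ζ n ⟨f, hf⟩ x
  have hcomm : ∀ i j : Fin d, Commute
      (((ζ i : ℝ) : ℂ) • dirDeriv (EuclideanSpace.single i (1 : ℝ)))
      (((ζ j : ℝ) : ℂ) • dirDeriv (EuclideanSpace.single j (1 : ℝ))) := fun i j =>
    ((dirDeriv_commute _ _).smul_left _).smul_right _
  rw [dirDeriv_eq_sum, Finset.sum_pow_eq_sum_piAntidiag_of_commute _ _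
    (fun i _ j _ _ => hcomm i j)] at h1
  rw [← h1]
  have h2 : ∀ (s : Finset (Fin d → ℕ)) (g : (Fin d → ℕ) → Module.End ℂ (smoothFun d)),
      ((∑ α ∈ s, g α) ⟨f, hf⟩).1 x = ∑ α ∈ s, ((g α) ⟨f, hf⟩).1 x := fun s g => by
    simp
  rw [h2]
  refine Finset.sum_congr rfl fun α _ => ?_
  have h3 : ∀ (l : List (Fin d)), (l.map fun i => (((ζ i : ℝ) : ℂ) •
      dirDeriv (EuclideanSpace.single i (1 : ℝ))) ^ α i).prod =
      ((l.map fun i => ((ζ i ^ α i : ℝ) : ℂ)).prod) •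
        (l.map fun i => dirDeriv (EuclideanSpace.single i (1 : ℝ)) ^ α i).prod := fun l => by
    induction l with
    | nil => simp
    | cons i l ih =>
      rw [List.map_cons, List.prod_cons, ih, List.map_cons, List.prod_cons, List.map_cons,
        List.prod_cons, smul_pow, smul_mul_smul_comm, ofReal_pow]
  have h4 : ∀ (g : Fin d → Module.End ℂ (smoothFun d)) (hc), Finset.univ.noncommProd g hc =
      ((List.finRange d).map g).prod := fun g hc => by
    rw [← Finset.noncommProd_toFinset (List.finRange d) g (by simpa using hc)
      (List.nodup_finRange d)]
    congr 1
    simp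
  rw [h4, h3, ← List.ofFn_eq_map, List.prod_ofFn, ← ofReal_prod]
  have h5 := congrFun (multiD_eq_prod α ⟨f, hf⟩) x
  simp only at h5
  rw [h5, Module.End.mul_apply]
  simp [← mul_assoc]
  ring

end Taylor

/-! ### Spherical means weighted by a harmonic polynomial -/

section SphereMean

variable {d : ℕ}

/-- The weighted spherical mean `r ↦ ∫_S f(r ζ) v(ζ) dζ`, for `r` of either sign. -/
noncomputable def sphereMean (v f : RSpace d → ℂ) (r : ℝ) : ℂ :=
  ∫ ζ : USphere d, f (r • (ζ : RSpace d)) * v ζ ∂(sphereProb d)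

/-- The `n`-th `r`-derivative of the integrand of `sphereMean`. -/
noncomputable def sphereMeanKernel (v f : RSpace d → ℂ) (n : ℕ) (r : ℝ) (ζ : USphere d) : ℂ :=
  iteratedFDeriv ℝ n f (r • (ζ : RSpace d)) (fun _ => ζ) * v ζ

theorem sphereMean_eq (v f : RSpace d → ℂ) :
    sphereMean v f = fun r => ∫ ζ, sphereMeanKernel v f 0 r ζ ∂(sphereProb d) := by
  ext r
  simp [sphereMean, sphereMeanKernel]

theorem continuous_sphereMeanKernel {v f : RSpace d → ℂ} (hv : Continuous v) (hf : ContDiff ℝ ∞ f)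
    (n : ℕ) : Continuous (Function.uncurry (sphereMeanKernel v f n)) := by
  have h1 : Continuous (iteratedFDeriv ℝ n f) :=
    hf.continuous_iteratedFDeriv (by exact_mod_cast le_top)
  have h2 : Continuous fun q : ℝ × USphere d => iteratedFDeriv ℝ n f (q.1 • (q.2 : RSpace d)) :=
    h1.comp (by fun_prop)
  have h3 : Continuous fun q : ℝ × USphere d => (fun _ : Fin n => (q.2 : RSpace d)) := by fun_prop
  exact (h2.eval h3).mul (by fun_prop)

theorem hasDerivAt_sphereMeanKernel (v : RSpace d → ℂ) {f : RSpace d → ℂ} (hf : ContDiff ℝ ∞ f)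
    (n : ℕ) (r : ℝ) (ζ : USphere d) : HasDerivAt (fun s => sphereMeanKernel v f n s ζ)
      (sphereMeanKernel v f (n + 1) r ζ) r := by
  have h1 := (hasFDerivAt_iteratedFDeriv_diag hf n ζ (r • (ζ : RSpace d))).comp_hasDerivAt r
    ((hasDerivAt_id r).smul_const (ζ : RSpace d))
  simp only [one_smul, fderiv_iteratedFDeriv_diag_apply] at h1
  exact h1.mul_const _

theorem iteratedDeriv_sphereMean (hd : 0 < d) {v f : RSpace d → ℂ} (hv : Continuous v)
    (hf : ContDiff ℝ ∞ f) (n : ℕ) : iteratedDeriv n (sphereMean v f) =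
      fun r => ∫ ζ, sphereMeanKernel v f n r ζ ∂(sphereProb d) := by
  have := isProbabilityMeasure_sphereProb hd
  rw [sphereMean_eq]
  exact iteratedDeriv_integral_of_compactSpace _ (continuous_sphereMeanKernel hv hf)
    (hasDerivAt_sphereMeanKernel v hf) n

theorem contDiff_sphereMean (hd : 0 < d) {v f : RSpace d → ℂ} (hv : Continuous v)
    (hf : ContDiff ℝ ∞ f) : ContDiff ℝ ∞ (sphereMean v f) := by
  have := isProbabilityMeasure_sphereProb hd
  rw [sphereMean_eq]
  exact contDiff_integral_of_compactSpace _ (continuous_sphereMeanKernel hv hf)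
    (hasDerivAt_sphereMeanKernel v hf)

theorem integrable_sphereProb (hd : 0 < d) {g : USphere d → ℂ} (hg : Continuous g) :
    Integrable g (sphereProb d) :=
  have := isProbabilityMeasure_sphereProb hd
  hg.integrable_of_hasCompactSupport (HasCompactSupport.of_compactSpace _)

open Classical in
theorem iteratedDeriv_sphereMean_zero (hd : 0 < d) {v f : RSpace d → ℂ} (hv : Continuous v)
    (hf : ContDiff ℝ ∞ f) (n : ℕ) : iteratedDeriv n (sphereMean v f) 0 =
      ∑ α ∈ Finset.piAntidiag (Finset.univ : Finset (Fin d)) n,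
        (Nat.multinomial Finset.univ α : ℂ) * multiD α f 0 *
          ∫ ζ : USphere d, ((∏ i, (ζ : RSpace d) i ^ α i : ℝ) : ℂ) * v ζ ∂(sphereProb d) := by
  rw [iteratedDeriv_sphereMean hd hv hf]
  simp only [sphereMeanKernel, zero_smul, iteratedFDeriv_diag_eq_sum hf, Finset.sum_mul]
  rw [integral_finsetSum]
  · refine Finset.sum_congr rfl fun α _ => ?_
    rw [← integral_const_mul]
    congr 1
    ext ζ
    ring
  · intro α _
    refine integrable_sphereProb hd ?_
    fun_prop

theorem iteratedDeriv_sphereMean_harmonic (hd : 0 < d) {m : ℕ} {P : MvPolynomial (Fin d) ℂ}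
    (hP : P.IsHomogeneous m) (hΔ : polyLaplacian P = 0) {f : RSpace d → ℂ} (hf : ContDiff ℝ ∞ f)
    {k : ℕ} (hk : k < m) : iteratedDeriv k (sphereMean (polyEval P) f) 0 = 0 := by
  classical
  rw [iteratedDeriv_sphereMean_zero hd (continuous_polyEval P) hf]
  refine Finset.sum_eq_zero fun α hα => ?_
  have hQ : (∏ i, MvPolynomial.X i ^ α i : MvPolynomial (Fin d) ℂ).IsHomogeneous k := by
    rw [← (Finset.mem_piAntidiag.1 hα).1]
    exact MvPolynomial.IsHomogeneous.prod _ _ _ fun i _ => by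
      simpa using (MvPolynomial.isHomogeneous_X ℂ i).pow (α i)
  have h1 := integral_sphereProb_mul_eq_zero hd hk hP hΔ hQ
  have h2 : ∀ ζ : USphere d, polyEval (∏ i, MvPolynomial.X i ^ α i) (ζ : RSpace d) =
      ((∏ i, (ζ : RSpace d) i ^ α i : ℝ) : ℂ) := fun ζ => by simp [polyEval]
  simp only [h2] at h1
  rw [h1, mul_zero]

theorem sphereMean_neg {m : ℕ} {P : MvPolynomial (Fin d) ℂ} (hP : P.IsHomogeneous m)
    (f : RSpace d → ℂ) (r : ℝ) :
    sphereMean (polyEval P) f (-r) = (-1) ^ m * sphereMean (polyEval P) f r := by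
  rw [sphereMean, ← integral_neg_sphereProb, sphereMean, ← integral_const_mul]
  congr 1
  ext ζ
  have h1 := polyEval_smul hP (-1) (ζ : RSpace d)
  have h2 : ((-ζ : USphere d) : RSpace d) = (-1 : ℝ) • (ζ : RSpace d) := by simp
  rw [h2, h1, smul_smul]
  simp only [neg_mul_neg, mul_one, ofReal_neg, ofReal_one]
  ring

theorem rapidlyDecreasing_sphereMean (hd : 0 < d) {v : RSpace d → ℂ} (hv : Continuous v) :
    RapidlyDecreasing (fun f : 𝓢(RSpace d, ℂ) => sphereMean v f) := by
  intro k n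
  have := isProbabilityMeasure_sphereProb hd
  obtain ⟨M, hM⟩ :=
    (isCompact_sphere (0 : RSpace d) 1).exists_bound_of_continuousOn hv.continuousOn
  refine ⟨{(k, n)}, max M 0, le_max_right _ _, fun f r => ?_⟩
  simp only [Finset.sup_singleton, SchwartzMap.schwartzSeminormFamily_apply]
  rw [norm_iteratedFDeriv_eq_norm_iteratedDeriv, iteratedDeriv_sphereMean hd hv (f.smooth ⊤)]
  have h1 : ‖((‖r‖ ^ k : ℝ) : ℂ)‖ = ‖r‖ ^ k := by
    rw [norm_real, Real.norm_of_nonneg (by positivity)]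
  rw [← h1, ← norm_mul, ← integral_const_mul]
  have h2 : ∀ ζ : USphere d, ‖((‖r‖ ^ k : ℝ) : ℂ) * sphereMeanKernel v f n r ζ‖ ≤
      max M 0 * SchwartzMap.seminorm ℂ k n f := fun ζ => by
    have hζ : ‖(ζ : RSpace d)‖ = 1 := by simp
    rw [norm_mul, h1, sphereMeanKernel, norm_mul]
    have h3 : ‖iteratedFDeriv ℝ n f (r • (ζ : RSpace d)) (fun _ => (ζ : RSpace d))‖ ≤
        ‖iteratedFDeriv ℝ n f (r • (ζ : RSpace d))‖ := by
      simpa [hζ] using (iteratedFDeriv ℝ n f (r • (ζ : RSpace d))).le_opNorm fun _ => (ζ : RSpace d)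
    have h4 := SchwartzMap.le_seminorm ℂ k n f (r • (ζ : RSpace d))
    rw [norm_smul, hζ, mul_one] at h4
    have h5 : ‖v ζ‖ ≤ max M 0 := (hM ζ ζ.2).trans (le_max_left _ _)
    calc _ ≤ ‖r‖ ^ k * (‖iteratedFDeriv ℝ n f (r • (ζ : RSpace d))‖ * max M 0) := by gcongr
      _ = max M 0 * (‖r‖ ^ k * ‖iteratedFDeriv ℝ n f (r • (ζ : RSpace d))‖) := by ring
      _ ≤ _ := by gcongr
  simpa using norm_integral_le_of_norm_le_const (μ := sphereProb d)
    (Filter.Eventually.of_forall h2)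

end SphereMean

/-! ### The lift as a smooth radial function -/

section Lift

variable {d : ℕ}

/-- The radial profile of the lift: the weighted spherical mean divided by `r ^ m`. -/
noncomputable def liftProfile (m : ℕ) (v f : RSpace d → ℂ) : ℝ → ℂ :=
  hadamardQuot^[m] (sphereMean v f)

theorem liftProfile_even {m : ℕ} {P : MvPolynomial (Fin d) ℂ} (hP : P.IsHomogeneous m)
    (f : RSpace d → ℂ) (r : ℝ) :
    liftProfile m (polyEval P) f (-r) = liftProfile m (polyEval P) f r :=
  iterate_hadamardQuot_even m (sphereMean_neg hP f) r

section

variable (hd : 0 < d) {m : ℕ} {P : MvPolynomial (Fin d) ℂ} (hP : P.IsHomogeneous m)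
  (hΔ : polyLaplacian P = 0)
include hd hP hΔ

theorem contDiff_liftProfile {f : RSpace d → ℂ} (hf : ContDiff ℝ ∞ f) :
    ContDiff ℝ ∞ (liftProfile m (polyEval P) f) :=
  (iterate_hadamardQuot (contDiff_sphereMean hd (continuous_polyEval P) hf) m fun _ hk =>
    iteratedDeriv_sphereMean_harmonic hd hP hΔ hf hk).1

theorem pow_mul_liftProfile {f : RSpace d → ℂ} (hf : ContDiff ℝ ∞ f) (r : ℝ) :
    (r : ℂ) ^ m * liftProfile m (polyEval P) f r = sphereMean (polyEval P) f r :=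
  (iterate_hadamardQuot (contDiff_sphereMean hd (continuous_polyEval P) hf) m fun _ hk =>
    iteratedDeriv_sphereMean_harmonic hd hP hΔ hf hk).2.1 r

theorem sphereLift_eq_liftProfile (p : ℕ) {u : RSpace d → ℂ} (hu : ∀ x, conj (u x) = polyEval P x)
    {f : RSpace d → ℂ} (hf : ContDiff ℝ ∞ f) (x : RSpace p) :
    sphereLift p m u f x = liftProfile m (polyEval P) f ‖x‖ := by
  classical
  unfold sphereLift
  split_ifs with hx
  · have h1 := (iterate_hadamardQuot (contDiff_sphereMean hd (continuous_polyEval P) hf) m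
      fun _ hk => iteratedDeriv_sphereMean_harmonic hd hP hΔ hf hk).2.2
    rw [hx, norm_zero, liftProfile, h1,
      iteratedDeriv_sphereMean_zero hd (continuous_polyEval P) hf, Finset.sum_div]
    refine Finset.sum_congr (by congr!) fun α hα => ?_
    simp only [hu]
    have h2 := Nat.multinomial_spec (Finset.univ : Finset (Fin d)) α
    rw [(Finset.mem_piAntidiag.1 hα).1] at h2
    rw [← h2]
    have h3 : ((∏ i, (α i).factorial : ℕ) : ℂ) ≠ 0 := by
      exact_mod_cast Finset.prod_ne_zero_iff.2 fun i _ => Nat.factorial_ne_zero _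
    have h4 : (Nat.multinomial Finset.univ α : ℂ) ≠ 0 := by
      intro h
      rw [Nat.cast_eq_zero] at h
      rw [h, mul_zero] at h2
      exact Nat.factorial_ne_zero _ h2.symm
    rw [Nat.cast_mul]
    field_simp
  · have hx' : ((‖x‖ : ℝ) : ℂ) ≠ 0 := by exact_mod_cast norm_ne_zero_iff.2 hx
    have h1 := pow_mul_liftProfile hd hP hΔ hf ‖x‖
    refine mul_left_cancel₀ (pow_ne_zero m hx') ?_
    rw [h1, sphereMean, ← integral_const_mul]
    congr 1
    ext ζ
    rw [hu, polyEval_smul hP, ofReal_inv, inv_pow]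
    field_simp

theorem rapidlyDecreasing_liftProfile (p : ℕ) :
    RapidlyDecreasing (fun (f : 𝓢(RSpace d, ℂ)) (x : RSpace p) =>
      liftProfile m (polyEval P) f ‖x‖) :=
  ((rapidlyDecreasing_sphereMean hd (continuous_polyEval P)).iterate_hadamardQuot
    (fun f => contDiff_sphereMean hd (continuous_polyEval P) (f.smooth ⊤)) m fun f _ hk =>
      iteratedDeriv_sphereMean_harmonic hd hP hΔ (f.smooth ⊤) hk).comp_norm
    (fun f => contDiff_liftProfile hd hP hΔ (f.smooth ⊤))
    fun f => liftProfile_even hP f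

/-- The profile at `0` is determined by continuity, and elsewhere by the spherical mean, so that it
depends linearly on `f`. -/
theorem liftProfile_ext {f : RSpace d → ℂ} (hf : ContDiff ℝ ∞ f) {ψ : ℝ → ℂ} (hψ : Continuous ψ)
    (h : ∀ r : ℝ, (r : ℂ) ^ m * ψ r = sphereMean (polyEval P) f r) :
    liftProfile m (polyEval P) f = ψ := by
  refine Continuous.ext_on (dense_compl_singleton (0 : ℝ))
    (contDiff_liftProfile hd hP hΔ hf).continuous hψ fun r hr => ?_
  have hr' : (r : ℂ) ≠ 0 := by exact_mod_cast hr
  exact mul_left_cancel₀ (pow_ne_zero m hr')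
    ((pow_mul_liftProfile hd hP hΔ hf r).trans (h r).symm)

theorem liftProfile_add {f g : RSpace d → ℂ} (hf : ContDiff ℝ ∞ f) (hg : ContDiff ℝ ∞ g) :
    liftProfile m (polyEval P) (fun x => f x + g x) =
      fun r => liftProfile m (polyEval P) f r + liftProfile m (polyEval P) g r := by
  refine liftProfile_ext hd hP hΔ (hf.add hg) ((contDiff_liftProfile hd hP hΔ hf).continuous.add
    (contDiff_liftProfile hd hP hΔ hg).continuous) fun r => ?_
  have hP' := continuous_polyEval P
  have hf' := hf.continuous
  have hg' := hg.continuous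
  rw [mul_add, pow_mul_liftProfile hd hP hΔ hf, pow_mul_liftProfile hd hP hΔ hg, sphereMean,
    sphereMean, sphereMean, ← integral_add]
  · simp only [add_mul]
  · exact integrable_sphereProb hd (by fun_prop)
  · exact integrable_sphereProb hd (by fun_prop)

theorem liftProfile_const_mul {f : RSpace d → ℂ} (hf : ContDiff ℝ ∞ f) (c : ℂ) :
    liftProfile m (polyEval P) (fun x => c * f x) =
      fun r => c * liftProfile m (polyEval P) f r := by
  refine liftProfile_ext hd hP hΔ (contDiff_const.mul hf)
    (continuous_const.mul (contDiff_liftProfile hd hP hΔ hf).continuous) fun r => ?_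
  rw [mul_left_comm, pow_mul_liftProfile hd hP hΔ hf, sphereMean, sphereMean, ← integral_const_mul]
  simp only [mul_assoc]

theorem contDiff_liftProfile_norm {f : RSpace d → ℂ} (hf : ContDiff ℝ ∞ f) (p : ℕ) :
    ContDiff ℝ ∞ (fun x : RSpace p => liftProfile m (polyEval P) f ‖x‖) :=
  contDiff_comp_norm (contDiff_liftProfile hd hP hΔ hf) (liftProfile_even hP f)

end

/-- The lift as a continuous linear map between Schwartz spaces. -/
noncomputable def liftCLM (hd : 0 < d) {m : ℕ} {P : MvPolynomial (Fin d) ℂ}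
    (hP : P.IsHomogeneous m) (hΔ : polyLaplacian P = 0) (p : ℕ) :
    𝓢(RSpace d, ℂ) →L[ℂ] 𝓢(RSpace p, ℂ) :=
  SchwartzMap.mkCLM (fun f x => liftProfile m (polyEval P) f ‖x‖)
    (fun f g x => congrFun (liftProfile_add hd hP hΔ (f.smooth ⊤) (g.smooth ⊤)) ‖x‖)
    (fun c f x => congrFun (liftProfile_const_mul hd hP hΔ (f.smooth ⊤) c) ‖x‖)
    (fun f => contDiff_liftProfile_norm hd hP hΔ (f.smooth ⊤) p)
    (fun n => rapidlyDecreasing_liftProfile hd hP hΔ p n.1 n.2)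

theorem liftCLM_apply (hd : 0 < d) {m : ℕ} {P : MvPolynomial (Fin d) ℂ}
    (hP : P.IsHomogeneous m) (hΔ : polyLaplacian P = 0) (p : ℕ) (f : 𝓢(RSpace d, ℂ))
    (x : RSpace p) : liftCLM hd hP hΔ p f x = liftProfile m (polyEval P) f ‖x‖ := rfl

end Lift

/-! ### The conjugate polynomial -/

theorem exists_conj_polyEval {d m : ℕ} {u : RSpace d → ℂ} (hu : IsHarmonicPoly d m u) :
    ∃ P : MvPolynomial (Fin d) ℂ, P.IsHomogeneous m ∧ polyLaplacian P = 0 ∧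
      ∀ x, conj (u x) = polyEval P x := by
  obtain ⟨⟨P, hP, hPu⟩, hh⟩ := hu
  have hu' : u = polyEval P := funext hPu
  refine ⟨MvPolynomial.map (starRingEnd ℂ) P, hP.map _, ?_, fun x => ?_⟩
  · rw [hu'] at hh
    have := congrArg (MvPolynomial.map (starRingEnd ℂ)) (polyLaplacian_eq_zero hh)
    simpa [polyLaplacian, MvPolynomial.pderiv_map] using this
  · rw [hPu]
    simp only [polyEval, MvPolynomial.eval_map]
    rw [MvPolynomial.eval, MvPolynomial.coe_eval₂Hom, MvPolynomial.hom_eval₂]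
    simp

/-! ### Radial functions are determined by their Gaussian integrals -/

section Uniqueness

variable {p : ℕ}

/-- A radial function vanishing at infinity is a continuous function of `e^{-π|x|²} ∈ [0, 1]`. -/
theorem exists_continuousOn_comp_exp (hp : 0 < p) {a : RSpace p → ℝ} (ha : Continuous a)
    (hrad : ∀ x y, ‖x‖ = ‖y‖ → a x = a y)
    (h0 : Filter.Tendsto a (Filter.cocompact _) (nhds 0)) :
    ∃ κ : ℝ → ℝ, ContinuousOn κ (Set.Icc 0 1) ∧
      ∀ x, a x = κ (Real.exp (-Real.pi * ‖x‖ ^ 2)) := by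
  set e : RSpace p := EuclideanSpace.single ⟨0, hp⟩ 1 with he
  have hen : ‖e‖ = 1 := by simp [he]
  set s : ℝ → RSpace p := fun y => √(-Real.log y / Real.pi) • e with hs
  have hsn : ∀ y, ‖s y‖ = √(-Real.log y / Real.pi) := fun y => by
    rw [hs, norm_smul, hen, mul_one, Real.norm_of_nonneg (Real.sqrt_nonneg _)]
  refine ⟨fun y => if y ≤ 0 then 0 else a (s y), fun y hy => ?_, fun x => ?_⟩
  · rcases hy.1.eq_or_lt with rfl | hy0
    · rw [ContinuousWithinAt, if_pos le_rfl, Metric.tendsto_nhds]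
      intro ε hε
      have h1 := (Metric.tendsto_nhds.1 h0) ε hε
      rw [← Metric.cobounded_eq_cocompact, ← comap_norm_atTop, Filter.eventually_comap,
        Filter.eventually_atTop] at h1
      obtain ⟨R, hR⟩ := h1
      refine mem_nhdsWithin_of_mem_nhds ?_
      filter_upwards [gt_mem_nhds (Real.exp_pos (-(Real.pi * R ^ 2)))] with y hy
      by_cases hy0 : y ≤ 0
      · simpa [hy0] using hε
      · rw [if_neg hy0]
        refine hR ‖s y‖ ?_ _ rfl
        rw [hsn]
        refine Real.le_sqrt_of_sq_le ?_
        rw [le_div_iff₀ Real.pi_pos]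
        have := Real.log_lt_log (not_le.1 hy0) hy
        rw [Real.log_exp] at this
        linarith
    · refine ContinuousAt.continuousWithinAt ?_
      have h1 : ContinuousAt (fun y => a (s y)) y := by
        refine ha.continuousAt.comp ?_
        have := (Real.continuousAt_log hy0.ne')
        exact ((this.neg.div_const _).sqrt).smul continuousAt_const
      refine h1.congr ?_
      filter_upwards [lt_mem_nhds hy0] with z hz
      rw [if_neg (not_le.2 hz)]
  · simp only [if_neg (not_le.2 (Real.exp_pos _))]
    refine hrad _ _ ?_
    rw [hsn, Real.log_exp]
    have : -(-Real.pi * ‖x‖ ^ 2) / Real.pi = ‖x‖ ^ 2 := by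
      have := Real.pi_ne_zero
      field_simp
    rw [this, Real.sqrt_sq (norm_nonneg x)]

theorem integrable_exp_neg_pi_sq : Integrable fun x : RSpace p =>
    Real.exp (-Real.pi * ‖x‖ ^ 2) := by
  have := (integrable_gauss (p := p) one_pos).norm
  simpa only [norm_gauss, mul_one] using this

theorem eq_zero_of_integral_exp_eq_zero (hp : 0 < p) {a : RSpace p → ℝ} (ha : Continuous a)
    (hrad : ∀ x y, ‖x‖ = ‖y‖ → a x = a y)
    (h0 : Filter.Tendsto a (Filter.cocompact _) (nhds 0)) {C : ℝ} (hC : ∀ x, |a x| ≤ C)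
    (h : ∀ n : ℕ, ∫ x, a x * Real.exp (-Real.pi * ‖x‖ ^ 2) ^ (n + 1) = 0) (x : RSpace p) :
    a x = 0 := by
  obtain ⟨κ, hκ, haκ⟩ := exists_continuousOn_comp_exp hp ha hrad h0
  set G : RSpace p → ℝ := fun x => Real.exp (-Real.pi * ‖x‖ ^ 2) with hG
  have hGc : Continuous G := by fun_prop
  have hG0 : ∀ x, 0 < G x := fun x => Real.exp_pos _
  have hG1 : ∀ x, G x ≤ 1 := fun x => Real.exp_le_one_iff.2 (by
    have := Real.pi_pos
    have : 0 ≤ Real.pi * ‖x‖ ^ 2 := by positivity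
    linarith)
  have hGi : Integrable G := integrable_exp_neg_pi_sq
  have hC0 : 0 ≤ C := (abs_nonneg _).trans (hC 0)
  -- Continuous bounded functions are integrable against the Gaussian.
  have hbi : ∀ {b : RSpace p → ℝ} {B : ℝ}, Continuous b → (∀ x, |b x| ≤ B) →
      Integrable fun x => b x * G x := fun hb hB =>
    hGi.bdd_mul hb.aestronglyMeasurable (Filter.Eventually.of_forall hB)
  have hpoly : ∀ q : Polynomial ℝ, ∫ x, a x * q.eval (G x) * G x = 0 := fun q => by
    have h1 : ∀ x, a x * q.eval (G x) * G x =
        ∑ n ∈ Finset.range (q.natDegree + 1), q.coeff n * (a x * G x ^ (n + 1)) := fun x => by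
      rw [Polynomial.eval_eq_sum_range, Finset.mul_sum, Finset.sum_mul]
      exact Finset.sum_congr rfl fun n _ => by ring
    simp only [h1]
    rw [integral_finsetSum]
    · refine Finset.sum_eq_zero fun n _ => ?_
      rw [integral_const_mul, h n, mul_zero]
    · intro n _
      refine Integrable.const_mul ?_ _
      have := hbi (b := fun x => a x * G x ^ n) (B := C) (by fun_prop) fun x => by
        rw [abs_mul, abs_of_nonneg (pow_nonneg (hG0 x).le n)]
        exact (mul_le_of_le_one_right (abs_nonneg _)
          (pow_le_one₀ (hG0 x).le (hG1 x))).trans (hC x)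
      refine this.congr (Filter.Eventually.of_forall fun x => ?_)
      simp only
      ring
  have hsq : Integrable fun x => a x * a x * G x :=
    hbi (B := C * C) (by fun_prop) fun x => by
      rw [abs_mul]
      exact mul_le_mul (hC x) (hC x) (abs_nonneg _) hC0
  have hnn : ∀ x, 0 ≤ a x * a x * G x := fun x => mul_nonneg (mul_self_nonneg _) (hG0 x).le
  -- Approximate one factor of `a ^ 2` by polynomials in `G`.
  have hle : ∀ ε > 0, ∫ x, a x * a x * G x ≤ ε * (C * ∫ x, G x) := fun ε hε => by
    obtain ⟨q, hq⟩ := exists_polynomial_near_of_continuousOn 0 1 κ hκ ε hε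
    have h1 : ∀ x, |a x - q.eval (G x)| ≤ ε := fun x => by
      rw [abs_sub_comm, haκ x]
      exact (hq (G x) ⟨(hG0 x).le, hG1 x⟩).le
    have h2 : ∀ x, |a x * (a x - q.eval (G x))| ≤ C * ε := fun x => by
      rw [abs_mul]
      exact mul_le_mul (hC x) (h1 x) (abs_nonneg _) hC0
    have hqc : Continuous fun x => q.eval (G x) := q.continuous.comp hGc
    have h3 := hbi (b := fun x => a x * (a x - q.eval (G x))) (by fun_prop) h2
    have h4 : ∫ x, a x * (a x - q.eval (G x)) * G x = ∫ x, a x * a x * G x := by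
      have h5 : ∀ x, a x * (a x - q.eval (G x)) * G x =
          a x * a x * G x - a x * q.eval (G x) * G x := fun x => by ring
      simp only [h5]
      rw [integral_sub hsq, hpoly, sub_zero]
      refine (hsq.sub h3).congr (Filter.Eventually.of_forall fun x => ?_)
      simp only [Pi.sub_apply]
      ring
    rw [← h4, ← mul_assoc, mul_comm ε C, ← integral_const_mul]
    refine integral_mono h3 (hGi.const_mul _) fun x => ?_
    exact mul_le_mul_of_nonneg_right ((le_abs_self _).trans (h2 x)) (hG0 x).le
  have hzero : ∫ x, a x * a x * G x = 0 := by
    refine le_antisymm ?_ (integral_nonneg hnn)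
    refine le_of_forall_pos_le_add fun δ hδ => ?_
    have hI : 0 ≤ C * ∫ x, G x := mul_nonneg hC0 (integral_nonneg fun x => (hG0 x).le)
    refine (hle (δ / (C * (∫ x, G x) + 1)) (by positivity)).trans ?_
    rw [zero_add, div_mul_eq_mul_div, div_le_iff₀ (by positivity)]
    nlinarith
  have hae := (integral_eq_zero_iff_of_nonneg hnn hsq).1 hzero
  have : a x * a x * G x = 0 :=
    congrFun ((Continuous.ae_eq_iff_eq volume (by fun_prop) continuous_const).1 hae) x
  simpa [(hG0 x).ne'] using this

theorem gauss_natCast (n : ℕ) (x : RSpace p) :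
    gauss n x = ((Real.exp (-Real.pi * ‖x‖ ^ 2) ^ n : ℝ) : ℂ) := by
  rw [gauss, ← Real.exp_nat_mul, ofReal_exp]
  congr 1
  push_cast
  ring

/-- A radial Schwartz function orthogonal to the Gaussians `e^{-π n |x|²}`, `n ≥ 1`, vanishes, by
the Weierstrass approximation theorem in the variable `e^{-π|x|²}`. -/
theorem schwartz_eq_zero_of_integral_gauss (hp : 0 < p) (K : 𝓢(RSpace p, ℂ))
    (hrad : IsRadialFun K) (h : ∀ n : ℕ, ∫ x, K x * gauss (n + 1 : ℕ) x = 0) (x : RSpace p) :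
    K x = 0 := by
  have hb : ∀ x, ‖K x‖ ≤ SchwartzMap.seminorm ℂ 0 0 K :=
    fun x => SchwartzMap.norm_le_seminorm ℂ K x
  have h0 : Filter.Tendsto K (Filter.cocompact _) (nhds 0) := zero_at_infty K
  have hi : ∀ n : ℕ, Integrable fun x => K x * gauss (n + 1 : ℕ) x := fun n =>
    (integrable_gauss (by positivity)).bdd_mul K.continuous.aestronglyMeasurable
      (Filter.Eventually.of_forall hb)
  have key : ∀ L : ℂ →L[ℝ] ℝ, (∀ z, |L z| ≤ ‖z‖) → L (K x) = 0 := fun L hL => by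
    refine eq_zero_of_integral_exp_eq_zero hp (a := fun x => L (K x))
      (L.continuous.comp K.continuous)
      (fun x y hxy => congrArg L (hrad x y hxy))
      (by simpa [Function.comp_def] using (L.continuous.tendsto 0).comp h0)
      (fun x => (hL _).trans (hb x)) (fun n => ?_) x
    have h1 := L.integral_comp_comm (hi n)
    rw [h n, map_zero] at h1
    rw [← h1]
    congr 1
    ext x
    rw [gauss_natCast, mul_comm (K x), ← real_smul, map_smul, smul_eq_mul, mul_comm]
  exact Complex.ext (key reCLM abs_re_le_norm) (key imCLM abs_im_le_norm)

end Uniqueness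

/-! ### The Fourier transform of the lift -/

section Fourier

variable {d : ℕ}

theorem fourier_polyEval_mul_gauss {t : ℝ} (ht : 0 < t) (P : MvPolynomial (Fin d) ℂ)
    (ξ : RSpace d) :
    𝓕 (fun x => polyEval P x * gauss t x) ξ = gaussWaveIntegral ht ξ P := by
  rw [Real.fourier_eq', gaussWaveIntegral_apply]
  congr 1
  ext x
  rw [gaussWave, Complex.exp_add, ← gauss, smul_eq_mul, real_inner_comm]
  have : cexp ((-2 * Real.pi * inner ℝ ξ x : ℝ) * I) =
      cexp (-(2 * Real.pi * I) * (inner ℝ ξ x : ℝ)) := by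
    congr 1
    push_cast
    ring
  rw [this]
  ring

/-- The constant in the Fourier transform of a Gaussian in dimension `p`. -/
noncomputable def gaussConst (t : ℝ) (p : ℕ) : ℂ :=
  (Real.pi / (Real.pi * t : ℝ) : ℂ) ^ (p / 2 : ℂ)

theorem fourier_gauss {p : ℕ} {t : ℝ} (ht : 0 < t) (ξ : RSpace p) :
    𝓕 (gauss t : RSpace p → ℂ) ξ = gaussConst t p * gauss t⁻¹ ξ := by
  have h1 := fourier_gaussian_innerProductSpace (V := RSpace p) (b := (Real.pi * t : ℝ))
    (by rw [ofReal_re]; positivity) ξ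
  rw [show Module.finrank ℝ (RSpace p) = p by simp] at h1
  refine h1.trans ?_
  rw [gaussConst, gauss]
  congr 2
  have : (t : ℂ) ≠ 0 := by exact_mod_cast ht.ne'
  have : (Real.pi : ℂ) ≠ 0 := by exact_mod_cast Real.pi_ne_zero
  push_cast
  field_simp

theorem gaussConst_add_two_mul {t : ℝ} (ht : 0 < t) (d m : ℕ) :
    gaussConst t (d + 2 * m) = gaussConst t d * (1 / t) ^ m := by
  have h1 : (t : ℂ) ≠ 0 := by exact_mod_cast ht.ne'
  have h2 : (Real.pi : ℂ) ≠ 0 := by exact_mod_cast Real.pi_ne_zero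
  have h3 : (Real.pi / (Real.pi * t : ℝ) : ℂ) = 1 / t := by
    push_cast
    field_simp
  rw [gaussConst, gaussConst, h3]
  have h4 : ((d + 2 * m : ℕ) / 2 : ℂ) = d / 2 + m := by
    push_cast
    ring
  rw [h4, cpow_add _ _ (by simpa using h1), cpow_natCast]

/-- Hecke's identity. -/
theorem fourier_harmonic_mul_gauss {t : ℝ} (ht : 0 < t) {m : ℕ} {P : MvPolynomial (Fin d) ℂ}
    (hP : P.IsHomogeneous m) (hΔ : polyLaplacian P = 0) (ξ : RSpace d) :
    𝓕 (fun x => polyEval P x * gauss t x) ξ =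
      (-I / t) ^ m * gaussConst t d * (polyEval P ξ * gauss t⁻¹ ξ) := by
  have h1 := fourier_polyEval_mul_gauss ht 1 ξ
  have h2 : (fun x : RSpace d => polyEval 1 x * gauss t x) = gauss t := by
    ext x; simp [polyEval]
  rw [h2, fourier_gauss ht] at h1
  rw [fourier_polyEval_mul_gauss ht, gaussWaveIntegral_harmonic ht ξ hP hΔ, ← h1]
  ring

theorem integral_fourier_mul_eq_of_integrable {p : ℕ} (f : 𝓢(RSpace p, ℂ)) {g : RSpace p → ℂ}
    (hg : Integrable g) : ∫ ξ, 𝓕 (f : RSpace p → ℂ) ξ * g ξ = ∫ x, f x * 𝓕 g x := by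
  simpa using! VectorFourier.integral_fourierIntegral_smul_eq_flip (L := innerₗ (RSpace p))
    Real.continuous_fourierChar continuous_inner f.integrable hg

theorem integrable_polyEval_mul_gauss (P : MvPolynomial (Fin d) ℂ) {t : ℝ} (ht : 0 < t) :
    Integrable fun x => polyEval P x * gauss t x := by
  simpa only [gaussWave_zero] using integrable_polyEval_mul_gaussWave P ht 0

variable (hd : 0 < d) {m : ℕ} {P : MvPolynomial (Fin d) ℂ} (hP : P.IsHomogeneous m)
  (hΔ : polyLaplacian P = 0)
include hd hP hΔ

/-- Polar coordinates in `ℝ^(d+2m)` and in `ℝ^d` relate the integral of the lift of `f` against a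
Gaussian to that of `f` times the harmonic polynomial. -/
theorem integral_liftCLM_mul_gauss {t : ℝ} (ht : 0 < t) (f : 𝓢(RSpace d, ℂ)) :
    ((volume : Measure (RSpace d)).toSphere.real Set.univ : ℂ) *
        ∫ x, liftCLM hd hP hΔ (d + 2 * m) f x * gauss t x =
      (volume : Measure (RSpace (d + 2 * m))).toSphere.real Set.univ *
        ∫ x, f x * (polyEval P x * gauss t x) := by
  have hb : ∀ {p : ℕ} (K : 𝓢(RSpace p, ℂ)) x, ‖K x‖ ≤ SchwartzMap.seminorm ℂ 0 0 K :=
    fun K x => SchwartzMap.norm_le_seminorm ℂ K x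
  have hp : 0 < d + 2 * m := by omega
  have hprob := isProbabilityMeasure_sphereProb hp
  rw [integral_eq_integral_sphereProb hd ((integrable_polyEval_mul_gauss P ht).bdd_mul
      f.continuous.aestronglyMeasurable (Filter.Eventually.of_forall (hb f))),
    integral_eq_integral_sphereProb hp ((integrable_gauss ht).bdd_mul
      (liftCLM hd hP hΔ (d + 2 * m) f).continuous.aestronglyMeasurable
      (Filter.Eventually.of_forall (hb _))), mul_left_comm]
  congr 2
  refine setIntegral_congr_fun measurableSet_Ioi fun r hr => ?_
  have hr : 0 < r := hr
  have hn : ∀ {p : ℕ} (ζ : USphere p), ‖r • (ζ : RSpace p)‖ = r := fun ζ => by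
    simp [norm_smul, abs_of_pos hr]
  simp only [liftCLM_apply, gauss, hn, polyEval_smul hP]
  have h1 : ∀ ζ : USphere d, f (r • (ζ : RSpace d)) * ((r : ℂ) ^ m * polyEval P ζ *
      cexp (-(Real.pi * t : ℝ) * r ^ 2)) = (r : ℂ) ^ m * cexp (-(Real.pi * t : ℝ) * r ^ 2) *
        (f (r • (ζ : RSpace d)) * polyEval P ζ) := fun ζ => by ring
  have h2 : d + 2 * m - 1 = d - 1 + m + m := by omega
  simp only [h1]
  have h3 : sphereMean (polyEval P) f r =
    ∫ ζ : USphere d, f (r • (ζ : RSpace d)) * polyEval P ζ ∂(sphereProb d) := rfl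
  rw [integral_const_mul, integral_const, integral_const_mul, ← h3,
    ← pow_mul_liftProfile hd hP hΔ (f.smooth ⊤), h2]
  simp only [probReal_univ, one_smul, pow_add]
  ring

/-- The lift to dimension `d + 2m` intertwines the Fourier transforms up to `i ^ m`: both sides are
radial and have the same integrals against the Gaussians `e^{-π n |x|²}`. -/
theorem fourier_liftCLM (f : 𝓢(RSpace d, ℂ)) :
    𝓕 (liftCLM hd hP hΔ (d + 2 * m) f) = I ^ m • liftCLM hd hP hΔ (d + 2 * m) (𝓕 f) := by
  have hp : 0 < d + 2 * m := by omega
  set L := liftCLM hd hP hΔ (d + 2 * m) with hL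
  have hradL : ∀ g, IsRadialFun (L g) := fun g x y hxy => by
    rw [hL, liftCLM_apply, liftCLM_apply, hxy]
  have hradF : IsRadialFun (𝓕 (L f) : 𝓢(RSpace (d + 2 * m), ℂ)) := fun x y hxy => by
    rw [SchwartzMap.fourier_coe]
    -- A reflection exchanges two points of equal norm, and the Fourier transform commutes with it.
    set A := (Submodule.span ℝ {x - y})ᗮ.reflection
    have hA : A x = y := Submodule.reflection_sub hxy
    have hLA : (L f : RSpace (d + 2 * m) → ℂ) ∘ A = L f :=
      funext fun z => hradL f _ _ (A.norm_map z)
    rw [← hA, ← Real.fourier_comp_linearIsometry, hLA]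
  have hzero := schwartz_eq_zero_of_integral_gauss hp (𝓕 (L f) - I ^ m • L (𝓕 f))
    (fun x y hxy => by
      simp only [sub_apply, smul_apply]
      rw [hradF x y hxy, hradL _ x y hxy]) fun n => by
    have ht : (0 : ℝ) < (n + 1 : ℕ) := by positivity
    set t : ℝ := ((n + 1 : ℕ) : ℝ)
    have ht' : (t : ℂ) ≠ 0 := by exact_mod_cast ht.ne'
    have hC : ((volume : Measure (RSpace d)).toSphere.real Set.univ : ℂ) ≠ 0 := by
      rw [ofReal_ne_zero, Measure.real, ENNReal.toReal_ne_zero]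
      exact ⟨toSphere_univ_ne_zero hd, measure_ne_top _ _⟩
    have hi : ∀ K : 𝓢(RSpace (d + 2 * m), ℂ), Integrable fun x => K x * gauss t x := fun K =>
      (integrable_gauss ht).bdd_mul K.continuous.aestronglyMeasurable
        (Filter.Eventually.of_forall (SchwartzMap.norm_le_seminorm ℂ K))
    have h1 : ∫ x, 𝓕 (L f) x * gauss t x =
        gaussConst t (d + 2 * m) * ∫ x, L f x * gauss t⁻¹ x := by
      rw [SchwartzMap.fourier_coe, integral_fourier_mul_eq_of_integrable _ (integrable_gauss ht),
        ← integral_const_mul]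
      simp only [fourier_gauss ht, mul_left_comm]
    have h2 : ∫ x, 𝓕 f x * (polyEval P x * gauss t x) = (-I / t) ^ m * gaussConst t d *
        ∫ x, f x * (polyEval P x * gauss t⁻¹ x) := by
      rw [SchwartzMap.fourier_coe, integral_fourier_mul_eq_of_integrable _
        (integrable_polyEval_mul_gauss P ht), ← integral_const_mul]
      simp only [fourier_harmonic_mul_gauss ht hP hΔ]
      congr 1
      ext x
      ring
    have h3 := integral_liftCLM_mul_gauss hd hP hΔ (inv_pos.2 ht) f
    have h4 := integral_liftCLM_mul_gauss hd hP hΔ ht (𝓕 f)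
    rw [h2] at h4
    rw [← hL] at h3 h4
    have h5 : ∀ x, (𝓕 (L f) - I ^ m • L (𝓕 f)) x * gauss t x =
        𝓕 (L f) x * gauss t x - I ^ m * (L (𝓕 f) x * gauss t x) := fun x => by
      simp only [sub_apply, smul_apply, smul_eq_mul]
      ring
    simp only [h5]
    rw [integral_sub (hi _) ((hi _).const_mul _), integral_const_mul, h1,
      gaussConst_add_two_mul ht]
    have h6 : I ^ m * (-I / t) ^ m = (1 / t : ℂ) ^ m := by
      rw [← mul_pow, mul_div_assoc', mul_neg, I_mul_I, neg_neg]
    refine (mul_eq_zero.1 ?_).resolve_left hC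
    linear_combination gaussConst t d * (1 / t : ℂ) ^ m * h3 - I ^ m * h4 -
      (volume : Measure (RSpace (d + 2 * m))).toSphere.real Set.univ * gaussConst t d *
        (∫ x, f x * (polyEval P x * gauss t⁻¹ x)) * h6
  ext x
  exact sub_eq_zero.1 (hzero x)

end Fourier

/-! ### The three properties of the lift -/

theorem mainTheorem5 (d m : ℕ) (hd : 2 ≤ d) (u : RSpace d → ℂ) (hu : IsHarmonicPoly d m u) :
    -- smooth functions are lifted to smooth radial functions
    (∀ p : ℕ, 1 ≤ p → ∀ f : RSpace d → ℂ, ContDiff ℝ ∞ f →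
      ContDiff ℝ ∞ (sphereLift p m u f) ∧ IsRadialFun (sphereLift p m u f)) ∧
    -- the lift is a continuous linear map from Schwartz functions to radial Schwartz functions
    (∀ p : ℕ, 1 ≤ p → ∃ T : 𝓢(RSpace d, ℂ) →L[ℂ] radialSchwartz p,
      ∀ f : 𝓢(RSpace d, ℂ), ⇑(T f : 𝓢(RSpace p, ℂ)) = sphereLift p m u (f : RSpace d → ℂ)) ∧
    -- in dimension `d + 2m` the lift intertwines the Fourier transforms up to `i ^ m`
    (∀ f : 𝓢(RSpace d, ℂ),
      𝓕 (sphereLift (d + 2 * m) m u (f : RSpace d → ℂ)) =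
        (Complex.I ^ m) • sphereLift (d + 2 * m) m u (𝓕 (f : RSpace d → ℂ))) := by
  have hd0 : 0 < d := by omega
  obtain ⟨P, hP, hΔ, hPu⟩ := exists_conj_polyEval hu
  have hlift : ∀ (p : ℕ) {f : RSpace d → ℂ}, ContDiff ℝ ∞ f →
      sphereLift p m u f = fun x => liftProfile m (polyEval P) f ‖x‖ := fun p _ hf =>
    funext (sphereLift_eq_liftProfile hd0 hP hΔ p hPu hf)
  have hCLM : ∀ (p : ℕ) (f : 𝓢(RSpace d, ℂ)),
      sphereLift p m u f = liftCLM hd0 hP hΔ p f := fun p f => hlift p (f.smooth ⊤)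
  refine ⟨fun p _ f hf => ?_, fun p _ => ?_, fun f => ?_⟩
  · rw [hlift p hf]
    exact ⟨contDiff_liftProfile_norm hd0 hP hΔ hf p, fun x y hxy => by simp only [hxy]⟩
  · refine ⟨(liftCLM hd0 hP hΔ p).codRestrict (radialSchwartz p) fun f x y hxy => ?_, fun f => ?_⟩
    · rw [liftCLM_apply, liftCLM_apply, hxy]
    · rw [hCLM]
      rfl
  · rw [← SchwartzMap.fourier_coe f, hCLM, hCLM, ← SchwartzMap.fourier_coe,
      fourier_liftCLM hd0 hP hΔ f]
    rfl
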